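/- **Setting.** Let $m\ge 1$ and $k_1,\dots,k_m\ge 1$ be integers, let $S_{ij}\subseteq\mathbb N$ ($1\le i\le m$, $1\le j\le k_i$) be finite sets with $0\in S_{ij}$, and let $0=d_1\le d_2\le\dots\le d_m$ be integers. Let $u_{ijs}$ ($s\in S_{ij}$) be independent standard Gaussian random variables and consider the random polynomial $$F(x)=\sum_{i=1}^m f_{i1}(x)\cdots f_{ik_i}(x)\,x^{d_i},\qquad f_{ij}(x)=\sum_{s\in S_{ij}}u_{ijs}x^s .$$ Put $\alpha_{ij}(x)=\sum_{s\in S_{ij}}x^{2s}$, $\beta_{ij}(x)=\sum_{s\in S_{ij}}x^s$ and $$q_i(x)=\left(\frac{\alpha_{i1}(x)\cdots\alpha_{ik_i}(x)}{\alpha_{11}(x)\cdots\alpha_{1k_1}(x)}\right)^{1/2},\qquad R(x)=\sum_{i=1}^m u_i\,q_i(x)\,x^{d_i},$$ where $u_1,\dots,u_m$ are independent and $u_i$ is distributed as the product of $k_i$ independent standard Gaussians; its density, at $a\neq0$, is $$\varpi_{k_i}(a)=\int_{\mathbb R^{k_i-1}}\varphi\Big(\frac{a}{y_2\cdots y_{k_i}}\Big)\varphi(y_2)\cdots\varphi(y_{k_i})\frac{dy_2}{|y_2|}\cdots\frac{dy_{k_i}}{|y_{k_i}|},\qquad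 \varphi(y)=(2\pi)^{-1/2}e^{-y^2/2}.$$ For a smooth $f:\mathbb R^N\to\mathbb R$, a probability density $\rho$ on $\mathbb R^N$, a regular value $a$ of $f$ and a measurable $Z:\mathbb R^N\to[0,\infty]$, write $$\mathbb E(Z\mid f=a)\,\rho_f(a)=\int_{f^{-1}(a)}Z\,\frac{\rho}{\|\nabla f\|}\,dH\in[0,\infty],$$ where $dH$ is the volume element of the hypersurface $f^{-1}(a)$. For fixed $x$ this is applied to $F(x)$, $|F'(x)|$ as functions of the coefficients $(u_{ijs})$ and to $R(x)$, $|R'(x)|$ as functions of $(u_1,\dots,u_m)$, with the respective joint densities; here $'$ is the derivative in $x$. **Proposition.** For all $x\in\mathbb R$ and all nonzero $a\in\mathbb R$, with $\zeta:=a\,\big(\alpha_{11}(x)\cdots\alpha_{1k_1}(x)\big)^{-1/2}$, $$\mathbb E\big(|F'(x)|\,\big|\,F(x)=a\big)\rho_{F(x)}(a)\;\le\;\frac1{\sqrt{2\pi}}\sum_{i=1}^m\sum_{j=1}^{k_i}\beta_{ij}'(|x|)+\sum_{i=1}^m\left|\frac{q_i'(x)}{q_i(x)}\right|+\mathbb E\big(|R'(x)|\,\big|\,R(x)=\zeta\big)\rho_{R(x)}(\zeta).$$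 -/

import Mathlib

open MeasureTheory ProbabilityTheory
open scoped ENNReal

namespace SPSP

noncomputable section

/-! ### Densities and conditional expectations on level sets -/

section LevelSets

variable {ι : Type*} [Fintype ι]

/-- The volume measure of the level set `f⁻¹(a)` in the Euclidean space `ℝ^ι`, which is a
hypersurface when `a` is a regular value: the `(N - 1)`-dimensional Hausdorff measure, `N = |ι|`,
normalized so as to agree with Lebesgue measure on Euclidean space of dimension `N - 1`
(the counting measure if `N = 1`). -/
def levelVolume (f : EuclideanSpace ℝ ι → ℝ) (a : ℝ) : Measure (EuclideanSpace ℝ ι) :=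
  (μHE[Fintype.card ι - 1]).restrict (f ⁻¹' {a})

/-- The pushforward density `ρ_f(a) = ∫_{f = a} ρ / ‖∇f‖`, with values in `[0, ∞]`. -/
def pushforwardDensity (ρ : EuclideanSpace ℝ ι → ℝ≥0∞) (f : EuclideanSpace ℝ ι → ℝ) (a : ℝ) :
    ℝ≥0∞ :=
  ∫⁻ u, ρ u / ENNReal.ofReal ‖gradient f u‖ ∂(levelVolume f a)

/-- The conditional expectation `𝔼(Z | f = a) = ∫_{f = a} Z ρ_H`, where
`ρ_H = ρ / (ρ_f(a) ‖∇f‖)` is the conditional density on the level set `H = {f = a}`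
(meaningful for a regular value `a` with `0 < ρ_f(a) < ∞`). -/
def condExpLevel (ρ : EuclideanSpace ℝ ι → ℝ≥0∞) (f : EuclideanSpace ℝ ι → ℝ)
    (Z : EuclideanSpace ℝ ι → ℝ≥0∞) (a : ℝ) : ℝ≥0∞ :=
  ∫⁻ u, Z u * ((pushforwardDensity ρ f a)⁻¹ * (ρ u / ENNReal.ofReal ‖gradient f u‖))
    ∂(levelVolume f a)

/-- The quantity `𝔼(Z | f = a) ρ_f(a)`, given at a regular value `a` of `f` by
`∫_{f = a} Z ρ / ‖∇f‖`; this is the product of `condExpLevel` and `pushforwardDensity` when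
`0 < ρ_f(a) < ∞`, and it is `0` when `ρ_f(a) = 0`. -/
def condExpMulDensity (ρ : EuclideanSpace ℝ ι → ℝ≥0∞) (f : EuclideanSpace ℝ ι → ℝ)
    (Z : EuclideanSpace ℝ ι → ℝ≥0∞) (a : ℝ) : ℝ≥0∞ :=
  ∫⁻ u, Z u * (ρ u / ENNReal.ofReal ‖gradient f u‖) ∂(levelVolume f a)

theorem condExpLevel_mul_pushforwardDensity (ρ : EuclideanSpace ℝ ι → ℝ≥0∞)
    (f : EuclideanSpace ℝ ι → ℝ) (Z : EuclideanSpace ℝ ι → ℝ≥0∞) (a : ℝ)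
    (h0 : pushforwardDensity ρ f a ≠ 0) (h1 : pushforwardDensity ρ f a ≠ ∞) :
    condExpLevel ρ f Z a * pushforwardDensity ρ f a = condExpMulDensity ρ f Z a := by
  unfold condExpLevel condExpMulDensity
  rw [← lintegral_mul_const' _ _ h1]
  refine lintegral_congr fun u => ?_
  calc Z u * ((pushforwardDensity ρ f a)⁻¹ * (ρ u / ENNReal.ofReal ‖gradient f u‖))
        * pushforwardDensity ρ f a
      = ((pushforwardDensity ρ f a)⁻¹ * pushforwardDensity ρ f a)
        * (Z u * (ρ u / ENNReal.ofReal ‖gradient f u‖)) := by ring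
    _ = Z u * (ρ u / ENNReal.ofReal ‖gradient f u‖) := by
        rw [ENNReal.inv_mul_cancel h0 h1, one_mul]

/-- For a random function `y ↦ G y u`, where the parameter `u ∈ ℝ^ι` has the density `ρ`, the
Rice integrand `𝔼(|G'(x)| | G(x) = a) ρ_{G(x)}(a)`. -/
def riceIntegrand (ρ : EuclideanSpace ℝ ι → ℝ≥0∞) (G : ℝ → EuclideanSpace ℝ ι → ℝ)
    (x a : ℝ) : ℝ≥0∞ :=
  condExpMulDensity ρ (G x) (fun u => ENNReal.ofReal |deriv (fun y => G y u) x|) a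

end LevelSets

/-- The density `ϖ_k` (for `k ≥ 1`) of the product of `k` independent standard Gaussians:
`ϖ_k(a) = ∫_{ℝ^{k-1}} φ(a / (y₂ ⋯ y_k)) φ(y₂) ⋯ φ(y_k) dy₂/|y₂| ⋯ dy_k/|y_k|`, where `φ` is the
standard Gaussian density. In particular `ϖ_1 = φ`. -/
def gaussianProdDensity (k : ℕ) (a : ℝ) : ℝ≥0∞ :=
  ∫⁻ y : Fin (k - 1) → ℝ, gaussianPDF 0 1 (a / ∏ j, y j) *
    ∏ j, (gaussianPDF 0 1 (y j) / ENNReal.ofReal |y j|)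

/-! ### Sums of products of sparse polynomials -/

section SumsOfProducts

variable {m : ℕ} {k : Fin m → ℕ}

/-- The indices `(i, j, s)`, `s ∈ S_{ij}`, of the coefficients `u_{ijs}`. -/
abbrev Params (S : (i : Fin m) → Fin (k i) → Finset ℕ) : Type :=
  Σ i : Fin m, Σ j : Fin (k i), S i j

/-- `F(x) = ∑_i f_{i1}(x) ⋯ f_{ik_i}(x) x^{d_i}` with `f_{ij}(x) = ∑_{s ∈ S_{ij}} u_{ijs} x^s`. -/
def sumProd (S : (i : Fin m) → Fin (k i) → Finset ℕ) (d : Fin m → ℕ) (x : ℝ)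
    (u : EuclideanSpace ℝ (Params S)) : ℝ :=
  ∑ i, (∏ j, ∑ s : S i j, u ⟨i, j, s⟩ * x ^ (s : ℕ)) * x ^ d i

/-- The joint density of independent standard Gaussian coefficients `u_{ijs}`. -/
def gaussianDensity (S : (i : Fin m) → Fin (k i) → Finset ℕ)
    (u : EuclideanSpace ℝ (Params S)) : ℝ≥0∞ :=
  ∏ l, gaussianPDF 0 1 (u l)

/-- `α_S(x) = ∑_{s ∈ S} x^{2s}`. -/
def alpha (S : Finset ℕ) (x : ℝ) : ℝ := ∑ s ∈ S, x ^ (2 * s)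

/-- `β_S(x) = ∑_{s ∈ S} x^s`. -/
def beta (S : Finset ℕ) (x : ℝ) : ℝ := ∑ s ∈ S, x ^ s

/-- `A_i(x) = α_{i1}(x) ⋯ α_{ik_i}(x)`, the variance of `f_{i1}(x) ⋯ f_{ik_i}(x)`. -/
def alphaProd (S : (i : Fin m) → Fin (k i) → Finset ℕ) (i : Fin m) (x : ℝ) : ℝ :=
  ∏ j, alpha (S i j) x

/-- `q_i(x) = (α_{i1}(x) ⋯ α_{ik_i}(x) / (α_{11}(x) ⋯ α_{1k_1}(x)))^{1/2}`; the first index of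
the summands is `0 : Fin m`. -/
def weightQ [NeZero m] (S : (i : Fin m) → Fin (k i) → Finset ℕ) (i : Fin m) (x : ℝ) : ℝ :=
  √(alphaProd S i x / alphaProd S 0 x)

/-- `R(x) = ∑_i u_i q_i(x) x^{d_i}`. -/
def linComb [NeZero m] (S : (i : Fin m) → Fin (k i) → Finset ℕ) (d : Fin m → ℕ) (x : ℝ)
    (u : EuclideanSpace ℝ (Fin m)) : ℝ :=
  ∑ i, u i * weightQ S i x * x ^ d i

/-- The joint density of independent `u_1, …, u_m`, where `u_i` is distributed as the product of
`k_i` independent standard Gaussians. -/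
def gaussianProdsDensity (k : Fin m → ℕ) (u : EuclideanSpace ℝ (Fin m)) : ℝ≥0∞ :=
  ∏ i, gaussianProdDensity (k i) (u i)

end SumsOfProducts

end

end SPSP

/-! Since 0 lies in every S_ij, F(x) is affine in the constant term u of each f_ij: F = C + B u,
where B (`cofactor`) is the product of the other factors of the i-th summand times x^{d_i}, and
neither B nor C involves u. Where B ≠ 0 the level set F = a is the graph u = (a - C)/B, and the
Jacobian of the graph divided by ‖∇F‖ is 1/|B|. So the part of 𝔼(Z | F = a) ρ_F(a) on B ≠ 0 is at
most the expectation of Z φ((a - C)/B)/|B| over the remaining coefficients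
(`IsAffineInCoord.condExpMulDensity_le`).

By the product rule, F' is the sum of the terms f_ij' B_ij and of D = ∑ (∏_j f_ij) d_i x^{d_i - 1}.
In the former |B_ij| cancels; with φ ≤ (2π)^{-1/2} and 𝔼|u_ijs| ≤ 1 each coefficient costs at most
s|x|^{s-1}/√(2π), which adds up to the β' term (`riceIntegrand_sumProd_le`).

For D, the equation is solved for a constant term in the first summand. As d_1 = 0, D does not see
that summand and B is almost surely nonzero; the locus B = 0 is negligible because a ≠ 0
(`condExpMulDensity_sumProd_le_setLIntegral`). The f_ij(x) are independent Gaussians of variance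
α_ij(x), so the products ∏_j f_ij(x) are A_i w_i with A_i = (∏_j α_ij)^{1/2} and w_i of density
ϖ_{k_i}. Integrating over the first block yields a rescaled ϖ_{k_1} (`lintegral_blocks`). Dividing
by A_1 gives the expectation of |∑ w_i q_i d_i x^{d_i - 1}| ϖ_{k_1}(ζ - ∑_{i>1} w_i q_i x^{d_i}).
This is the integrand for R, except that R' has the extra terms w_i q_i' x^{d_i}; since |t| ϖ_k(t) ≤
1, each of them costs at most |q_i'/q_i| (`lintegral_abs_mul_deriv_weightQ_le`).

For F only an upper bound on level-set integrals is needed. A lower bound is needed only for R,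
whose level sets are hyperplanes, so the area formula for affine maps suffices there. -/

namespace SPSP

/-! ### Area formula: upper bound for smooth maps, equality for affine maps -/

section AreaFormula

open Module Topology Filter

variable {U V : Type*} [NormedAddCommGroup U] [InnerProductSpace ℝ U] [FiniteDimensional ℝ U]
  [NormedAddCommGroup V] [InnerProductSpace ℝ V]

theorem euclideanHausdorffMeasure_image_le_of_lipschitzOnWith {X Y : Type*} [EMetricSpace X]
    [MeasurableSpace X] [BorelSpace X] [EMetricSpace Y] [MeasurableSpace Y] [BorelSpace Y]
    {K : NNReal} {f : X → Y} {s : Set X} (h : LipschitzOnWith K f s) (n : ℕ) :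
    μHE[n] (f '' s) ≤ (K : ℝ≥0∞) ^ n * μHE[n] s := by
  have h1 := h.hausdorffMeasure_image_le (d := n) (by positivity)
  rw [ENNReal.rpow_natCast] at h1
  simp only [Measure.euclideanHausdorffMeasure_def, Measure.smul_apply, ENNReal.smul_def,
    smul_eq_mul]
  rw [mul_left_comm]
  gcongr

/-- Near a point where it has an injective strict derivative `A`, a map distorts distances at most
slightly more than `A`. -/
theorem exists_nhds_lipschitz_comparison {Φ : U → V} {A : U →L[ℝ] V} {y : U}
    (h : HasStrictFDerivAt Φ A y) (hA : Function.Injective A) {K : NNReal} (hK : 1 < K) :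
    ∃ W ∈ 𝓝 y, ∀ z ∈ W, ∀ z' ∈ W, dist (Φ z) (Φ z') ≤ K * dist (A z) (A z') := by
  obtain ⟨c, hc, hanti⟩ := (A : U →ₗ[ℝ] V).injective_iff_antilipschitz.1 hA
  have hKr : (1 : ℝ) < K := hK
  have hcr : (0 : ℝ) < c := hc
  -- With this tolerance the linearization error is at most (K - 1)‖A(z - z')‖, because ‖v‖ ≤ c‖A
  -- v‖.
  have hpos : 0 < ((K : ℝ) - 1) / c := by
    apply div_pos _ hcr
    linarith
  have h1 := h.isLittleO.def hpos
  rw [nhds_prod_eq] at h1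
  obtain ⟨W, hW, hW'⟩ := Filter.eventually_prod_self_iff'.1 h1 |> fun h => h
  refine ⟨W, hW, fun z hz z' hz' => ?_⟩
  have h2 := hW' z hz z' hz'
  have h3 : ‖z - z'‖ ≤ c * ‖A (z - z')‖ := by
    have := hanti.le_mul_dist z z'
    simpa [dist_eq_norm, map_sub] using this
  rw [dist_eq_norm, dist_eq_norm, ← map_sub]
  calc ‖Φ z - Φ z'‖ = ‖(Φ z - Φ z' - A (z - z')) + A (z - z')‖ := by congr 1; abel
    _ ≤ ((K : ℝ) - 1) / c * ‖z - z'‖ + ‖A (z - z')‖ := (norm_add_le _ _).trans (by gcongr)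
    _ ≤ ((K : ℝ) - 1) / c * (c * ‖A (z - z')‖) + ‖A (z - z')‖ := by gcongr
    _ = K * ‖A (z - z')‖ := by field_simp; ring

/-- The volume factor of a graph. -/
theorem normDet_sq_of_inner_eq {κ : Type*} [Fintype κ] {A : U →ₗ[ℝ] V} {c : U →ₗ[ℝ] ℝ}
    (b : OrthonormalBasis κ ℝ U) (h : ∀ v w, inner ℝ (A v) (A w) = inner ℝ v w + c v * c w) :
    A.normDet ^ 2 = 1 + ∑ i, c (b i) ^ 2 := by
  classical
  have h1 := A.normDet_sq_eq_det_gram b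
  -- The Gram matrix is a rank-one perturbation of the identity, so the matrix determinant lemma
  -- applies.
  have h2 : Matrix.gram ℝ (fun i => A (b i)) = 1 + Matrix.replicateCol Unit (fun i => c (b i)) *
      Matrix.replicateRow Unit (fun i => c (b i)) := by
    ext i j
    rw [Matrix.gram_apply, h, orthonormal_iff_ite.1 b.orthonormal i j]
    simp [Matrix.one_apply, Matrix.mul_apply]
  rw [h2, Matrix.det_one_add_replicateCol_mul_replicateRow] at h1
  simpa [dotProduct, sq] using h1

variable [MeasurableSpace U] [BorelSpace U] [MeasurableSpace V] [BorelSpace V]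

/-- On s, Φ factors as (Φ ∘ A⁻¹) ∘ A. The hypothesis makes the first map K-Lipschitz on A(s), and
the measure of A(s) is given by the linear area formula. -/
theorem euclideanHausdorffMeasure_image_le_of_comparison {Φ : U → V} {A : U →L[ℝ] V}
    (hA : Function.Injective A) {K : NNReal} {s : Set U}
    (h : ∀ z ∈ s, ∀ z' ∈ s, dist (Φ z) (Φ z') ≤ K * dist (A z) (A z')) :
    μHE[finrank ℝ U] (Φ '' s) ≤
      (K : ℝ≥0∞) ^ finrank ℝ U * (ENNReal.ofReal (A : U →ₗ[ℝ] V).normDet * volume s) := by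
  have h1 : LipschitzOnWith K (Φ ∘ Function.invFun A) (A '' s) := by
    refine LipschitzOnWith.of_dist_le_mul ?_
    rintro _ ⟨z, hz, rfl⟩ _ ⟨z', hz', rfl⟩
    simpa [Function.leftInverse_invFun hA _] using h z hz z' hz'
  have h2 := euclideanHausdorffMeasure_image_le_of_lipschitzOnWith h1 (finrank ℝ U)
  have h3 : (Φ ∘ Function.invFun A) '' (A '' s) = Φ '' s := by
    rw [Set.image_image]
    simp [Function.leftInverse_invFun hA _]
  rw [h3] at h2
  have h4 := (A : U →ₗ[ℝ] V).euclideanHausdorffMeasure_image_eq_normDet_mul_volume s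
  rwa [← h4]

/-- The upper bound in the area formula for the Euclidean Hausdorff measure. -/
theorem euclideanHausdorffMeasure_image_le_lintegral {Φ : U → V} {Φ' : U → U →L[ℝ] V} {s : Set U}
    (hs : MeasurableSet s) (hd : ∀ y ∈ s, HasStrictFDerivAt Φ (Φ' y) y)
    (hinj : ∀ y ∈ s, Function.Injective (Φ' y))
    (hJ : ∀ y ∈ s, ContinuousAt (fun z => (Φ' z : U →ₗ[ℝ] V).normDet) y) :
    μHE[finrank ℝ U] (Φ '' s) ≤
      ∫⁻ y in s, ENNReal.ofReal (Φ' y : U →ₗ[ℝ] V).normDet := by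
  set J : U → ℝ := fun z => (Φ' z : U →ₗ[ℝ] V).normDet with hJdef
  -- Locally, K^n is lost by comparing Φ with its linearization, and one more K by comparing the
  -- Jacobian with its value at the base point. Afterwards K tends to 1.
  have key : ∀ K : NNReal, 1 < K → μHE[finrank ℝ U] (Φ '' s) ≤
      (K : ℝ≥0∞) ^ (finrank ℝ U + 1) * ∫⁻ y in s, ENNReal.ofReal (J y) := by
    intro K hK
    have hKr : (1 : ℝ) < K := hK
    have hloc : ∀ y ∈ s, ∃ W, IsOpen W ∧ y ∈ W ∧ ∀ r ⊆ s ∩ W, MeasurableSet r →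
        μHE[finrank ℝ U] (Φ '' r) ≤
          (K : ℝ≥0∞) ^ (finrank ℝ U + 1) * ∫⁻ y in r, ENNReal.ofReal (J y) := by
      intro y hy
      obtain ⟨W₁, hW₁, hc⟩ := exists_nhds_lipschitz_comparison (hd y hy) (hinj y hy) hK
      have hJpos : 0 < J y := lt_of_le_of_ne (LinearMap.normDet_nonneg _)
        (Ne.symm (((Φ' y : U →ₗ[ℝ] V).normDet_ne_zero_tfae.out 0 4).2 (hinj y hy)))
      have hW₂ : {z | J y < K * J z} ∈ 𝓝 y := by
        have : ContinuousAt (fun z => K * J z) y := continuousAt_const.mul (hJ y hy)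
        refine this.eventually (lt_mem_nhds ?_)
        nlinarith
      obtain ⟨W, hW, hWo, hyW⟩ := mem_nhds_iff.1 (inter_mem hW₁ hW₂)
      refine ⟨W, hWo, hyW, fun r hr hrm => ?_⟩
      have h1 := euclideanHausdorffMeasure_image_le_of_comparison (hinj y hy) (K := K) (s := r)
        fun z hz z' hz' => hc z (hW (hr hz).2).1 z' (hW (hr hz').2).1
      refine h1.trans ?_
      rw [pow_succ, mul_assoc]
      refine mul_le_mul_right ?_ _
      rw [← setLIntegral_const, ← lintegral_const_mul' _ _ ENNReal.coe_ne_top]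
      refine setLIntegral_mono' hrm fun z hz => ?_
      rw [← ENNReal.ofReal_coe_nnreal, ← ENNReal.ofReal_mul K.coe_nonneg]
      exact ENNReal.ofReal_le_ofReal (hW (hr hz).2).2.le
    choose! W hWo hyW hW using hloc
    obtain ⟨t, hts, htc, hcov⟩ := TopologicalSpace.countable_cover_nhdsWithin
      (fun y hy => mem_nhdsWithin_of_mem_nhds ((hWo y hy).mem_nhds (hyW y hy)))
    rcases s.eq_empty_or_nonempty with rfl | hne
    · simp
    have htne : t.Nonempty := by
      obtain ⟨y, hy⟩ := hne
      obtain ⟨i, hi, -⟩ := Set.mem_iUnion₂.1 (hcov hy)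
      exact ⟨i, hi⟩
    obtain ⟨f, rfl⟩ := htc.exists_eq_range htne
    have hf : ∀ n, f n ∈ s := fun n => hts ⟨n, rfl⟩
    -- A countable subcover, made disjoint so that the integrals over the pieces add up to the
    -- integral over s.
    set D : ℕ → Set U := fun n => s ∩ disjointed (fun n => W (f n)) n
    have hDm : ∀ n, MeasurableSet (D n) := fun n =>
      hs.inter (MeasurableSet.disjointed (fun n => (hWo _ (hf n)).measurableSet) n)
    have hDs : s = ⋃ n, D n := by
      rw [← Set.inter_iUnion, iUnion_disjointed, eq_comm, Set.inter_eq_left]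
      simpa using hcov
    have hDd : Pairwise (Function.onFun Disjoint D) := fun i j hij =>
      (disjoint_disjointed (fun n => W (f n)) hij).mono Set.inter_subset_right
        Set.inter_subset_right
    calc μHE[finrank ℝ U] (Φ '' s) = μHE[finrank ℝ U] (⋃ n, Φ '' D n) := by
          rw [← Set.image_iUnion, ← hDs]
      _ ≤ ∑' n, μHE[finrank ℝ U] (Φ '' D n) := measure_iUnion_le _
      _ ≤ ∑' n, (K : ℝ≥0∞) ^ (finrank ℝ U + 1) * ∫⁻ y in D n, ENNReal.ofReal (J y) := by
          gcongr with n
          exact hW _ (hf n) _ (Set.inter_subset_inter_right _ (disjointed_subset _ _)) (hDm n)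
      _ = _ := by
          rw [ENNReal.tsum_mul_left, ← lintegral_iUnion hDm hDd, ← hDs]
  have hlim : Tendsto (fun K : NNReal => (K : ℝ≥0∞) ^ (finrank ℝ U + 1) *
      ∫⁻ y in s, ENNReal.ofReal (J y)) (𝓝[>] 1) (𝓝 (((1 : NNReal) : ℝ≥0∞) ^ (finrank ℝ U + 1) *
      ∫⁻ y in s, ENNReal.ofReal (J y))) := by
    refine tendsto_nhdsWithin_of_tendsto_nhds ?_
    -- The limit of the factor is 1 ≠ 0, so the integral is allowed to be infinite.
    refine ENNReal.Tendsto.mul_const ?_ (Or.inl (by simp))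
    exact ((ENNReal.continuous_pow _).comp ENNReal.continuous_coe).tendsto 1
  simp only [ENNReal.coe_one, one_pow, one_mul] at hlim
  have : (𝓝[>] (1 : NNReal)).NeBot := nhdsGT_neBot_of_exists_gt ⟨2, by norm_num⟩
  exact ge_of_tendsto hlim (eventually_nhdsWithin_of_forall key)

/-- Translations are isometries, so the linear formula carries over. Being an equality, it also
supplies the lower bound needed for R. -/
theorem euclideanHausdorffMeasure_affine_image (p : V) (A : U →L[ℝ] V) (s : Set U) :
    μHE[finrank ℝ U] ((fun y => p + A y) '' s) =
      ENNReal.ofReal (A : U →ₗ[ℝ] V).normDet * volume s := by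
  have h4 := (A : U →ₗ[ℝ] V).euclideanHausdorffMeasure_image_eq_normDet_mul_volume s
  rw [ContinuousLinearMap.coe_coe] at h4
  rw [← h4, ← (isometry_add_left p).euclideanHausdorffMeasure_image (A '' s), Set.image_image]

end AreaFormula

/-! ### Product measures of measures with densities -/

section ProductDensities

variable {ι : Type*} [Fintype ι]

theorem lintegral_pi_prod {X : ι → Type*} [∀ i, MeasurableSpace (X i)]
    (μ : ∀ i, Measure (X i)) [∀ i, SigmaFinite (μ i)] {f : ∀ i, X i → ℝ≥0∞}
    (hf : ∀ i, Measurable (f i)) :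
    ∫⁻ x, ∏ i, f i (x i) ∂Measure.pi μ = ∏ i, ∫⁻ t, f i t ∂μ i := by
  classical
  have hm : Measurable (fun x : ∀ i, X i => ∏ i, f i (x i)) :=
    Finset.measurable_prod _ fun i _ => (hf i).comp (measurable_pi_apply i)
  -- Induction on the set of coordinates already integrated out.
  have key : ∀ s : Finset ι, ∀ x, (∫⋯∫⁻_s, (fun x : ∀ i, X i => ∏ i, f i (x i)) ∂μ) x =
      (∏ i ∈ s, ∫⁻ t, f i t ∂μ i) * ∏ i ∈ sᶜ, f i (x i) := by
    intro s
    induction s using Finset.induction_on with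
    | empty => intro x; simp
    | insert i s hi ih =>
      intro x
      rw [lmarginal_insert _ hm hi]
      simp_rw [ih]
      have h1 : ∀ t, ∏ j ∈ sᶜ, f j (Function.update x i t j) =
          f i t * ∏ j ∈ (insert i s)ᶜ, f j (x j) := by
        intro t
        rw [← Finset.mul_prod_erase _ _ (Finset.mem_compl.2 hi), Function.update_self,
          Finset.compl_insert]
        congr 1
        refine Finset.prod_congr rfl fun j hj => ?_
        rw [Function.update_of_ne (Finset.ne_of_mem_erase hj)]
      simp_rw [h1, ← mul_assoc]
      rw [Finset.prod_insert hi]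
      rw [lintegral_mul_const _ ((hf i).const_mul _), lintegral_const_mul _ (hf i)]
      ring
  by_cases hne : Nonempty (∀ i, X i)
  · obtain ⟨x⟩ := hne
    rw [lintegral_eq_lmarginal_univ x, key]
    simp
  · rw [not_nonempty_iff] at hne
    obtain ⟨i, hi⟩ := isEmpty_pi.1 hne
    rw [Finset.prod_eq_zero (Finset.mem_univ i) (by rw [lintegral_of_isEmpty])]
    rw [lintegral_of_isEmpty]

theorem pi_withDensity {p : ι → ℝ → ℝ≥0∞} (hp : ∀ i, Measurable (p i))
    [∀ i, SigmaFinite ((volume : Measure ℝ).withDensity (p i))] :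
    Measure.pi (fun i => (volume : Measure ℝ).withDensity (p i)) =
      (volume : Measure (ι → ℝ)).withDensity (fun u => ∏ i, p i (u i)) := by
  refine Measure.pi_eq (μ := fun i => (volume : Measure ℝ).withDensity (p i)) fun s hs => ?_
  rw [withDensity_apply _ (MeasurableSet.univ_pi hs), ← lintegral_indicator (MeasurableSet.univ_pi hs)]
  simp_rw [withDensity_apply _ (hs _), ← lintegral_indicator (hs _)]
  rw [volume_pi, ← lintegral_pi_prod (fun _ => volume) fun i => (hp i).indicator (hs i)]
  refine lintegral_congr fun u => ?_
  by_cases h : u ∈ Set.univ.pi s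
  · rw [Set.indicator_of_mem h]
    exact Finset.prod_congr rfl fun i _ => (Set.indicator_of_mem (h i trivial) _).symm
  · rw [Set.indicator_of_notMem h]
    simp only [Set.mem_univ_pi, not_forall] at h
    obtain ⟨i, hi⟩ := h
    exact (Finset.prod_eq_zero (Finset.mem_univ i) (Set.indicator_of_notMem hi _)).symm

end ProductDensities

noncomputable section

/-! ### Level sets of functions affine in one coordinate, as graphs -/

section Graph

open Module Topology Filter

variable {ι : Type*} [DecidableEq ι]

/-- Replace the coordinate `l` of `u` by `t`. -/
def updateCoord (l : ι) (u : EuclideanSpace ℝ ι) (t : ℝ) : EuclideanSpace ℝ ι :=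
  WithLp.toLp 2 (Function.update u.ofLp l t)

@[simp] theorem updateCoord_self (l : ι) (u : EuclideanSpace ℝ ι) (t : ℝ) :
    updateCoord l u t l = t := by simp [updateCoord]

theorem updateCoord_of_ne {l j : ι} (h : j ≠ l) (u : EuclideanSpace ℝ ι) (t : ℝ) :
    updateCoord l u t j = u j := by simp [updateCoord, h]

theorem updateCoord_eq_self (l : ι) (u : EuclideanSpace ℝ ι) : updateCoord l u (u l) = u := by
  ext j
  by_cases h : j = l
  · subst h; simp
  · rw [updateCoord_of_ne h]

variable [Fintype ι]

/-- The coordinate hyperplane `u_l = 0`, parametrized isometrically. -/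
def coordHyperplane (l : ι) : EuclideanSpace ℝ {j // j ≠ l} →ₗᵢ[ℝ] EuclideanSpace ℝ ι where
  toFun y := WithLp.toLp 2 fun j => if h : j = l then 0 else y ⟨j, h⟩
  map_add' y z := by ext j; by_cases h : j = l <;> simp [h]
  map_smul' c y := by ext j; by_cases h : j = l <;> simp [h]
  norm_map' y := by
    rw [← sq_eq_sq₀ (norm_nonneg _) (norm_nonneg _), EuclideanSpace.real_norm_sq_eq,
      EuclideanSpace.real_norm_sq_eq, Fintype.sum_eq_add_sum_subtype_ne _ l]
    simp only [LinearMap.coe_mk, AddHom.coe_mk, dite_true, ne_eq, OfNat.ofNat_ne_zero,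
      not_false_eq_true, zero_pow, zero_add]
    exact Finset.sum_congr rfl fun j _ => by rw [dif_neg j.2]

@[simp] theorem coordHyperplane_self (l : ι) (y : EuclideanSpace ℝ {j // j ≠ l}) :
    coordHyperplane l y l = 0 := by simp [coordHyperplane]

@[simp] theorem coordHyperplane_coe (l : ι) (y : EuclideanSpace ℝ {j // j ≠ l})
    (j : {j // j ≠ l}) : coordHyperplane l y j = y j := by
  simp [coordHyperplane, j.2]

theorem coordHyperplane_add_smul (l : ι) (y : EuclideanSpace ℝ {j // j ≠ l}) (t : ℝ) :
    coordHyperplane l y + t • EuclideanSpace.single l 1 = updateCoord l (coordHyperplane l y) t := by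
  ext j
  by_cases h : j = l
  · subst h; simp
  · simp [updateCoord_of_ne h, h]

theorem updateCoord_coordHyperplane (l : ι) (u : EuclideanSpace ℝ ι) (t : ℝ) :
    updateCoord l (coordHyperplane l (WithLp.toLp 2 fun j : {j // j ≠ l} => u j)) t =
      updateCoord l u t := by
  ext j
  by_cases h : j = l
  · subst h; simp
  · rw [updateCoord_of_ne h, updateCoord_of_ne h]
    exact coordHyperplane_coe l _ ⟨j, h⟩

theorem coordHyperplane_single (l : ι) (j : {j // j ≠ l}) :
    coordHyperplane l (EuclideanSpace.single j 1) = EuclideanSpace.single (j : ι) (1 : ℝ) := by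
  ext i
  by_cases h : i = l
  · subst h; simp [j.2.symm]
  · have := coordHyperplane_coe l (EuclideanSpace.single j 1) ⟨i, h⟩
    simp only at this
    rw [this]
    simp [Subtype.ext_iff]

theorem inner_coordHyperplane_single (l : ι) (y : EuclideanSpace ℝ {j // j ≠ l}) :
    inner ℝ (coordHyperplane l y) (EuclideanSpace.single l (1 : ℝ)) = 0 := by
  rw [EuclideanSpace.inner_single_right, coordHyperplane_self]
  simp

theorem norm_gradient_sq (F : EuclideanSpace ℝ ι → ℝ) (u : EuclideanSpace ℝ ι) :
    ‖gradient F u‖ ^ 2 = ∑ i, (fderiv ℝ F u (EuclideanSpace.single i 1)) ^ 2 := by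
  rw [EuclideanSpace.real_norm_sq_eq]
  refine Finset.sum_congr rfl fun i _ => ?_
  congr 1
  rw [gradient, ← InnerProductSpace.toDual_symm_apply, EuclideanSpace.inner_single_right]
  simp

/-- The function `F = C + B u_l` is affine in the coordinate `u_l`. -/
structure IsAffineInCoord (l : ι) (F C B : EuclideanSpace ℝ ι → ℝ) : Prop where
  contDiff_left : ContDiff ℝ 1 C
  contDiff_right : ContDiff ℝ 1 B
  eq : ∀ u, F u = C u + B u * u l
  left_update : ∀ u t, C (updateCoord l u t) = C u
  right_update : ∀ u t, B (updateCoord l u t) = B u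

namespace IsAffineInCoord

variable {l : ι} {F C B : EuclideanSpace ℝ ι → ℝ}

/-- The level set `F = a` is the graph of this function where `B` does not vanish. -/
def height (l : ι) (C B : EuclideanSpace ℝ ι → ℝ) (a : ℝ) (y : EuclideanSpace ℝ {j // j ≠ l}) : ℝ :=
  (a - C (coordHyperplane l y)) / B (coordHyperplane l y)

/-- The graph parametrization of the level set `F = a`. -/
def param (l : ι) (C B : EuclideanSpace ℝ ι → ℝ) (a : ℝ) (y : EuclideanSpace ℝ {j // j ≠ l}) :
    EuclideanSpace ℝ ι :=
  coordHyperplane l y + height l C B a y • EuclideanSpace.single l 1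

/-- The derivative of the graph parametrization. -/
def paramDeriv (l : ι) (c : EuclideanSpace ℝ {j // j ≠ l} →L[ℝ] ℝ) :
    EuclideanSpace ℝ {j // j ≠ l} →L[ℝ] EuclideanSpace ℝ ι :=
  (coordHyperplane l).toContinuousLinearMap + c.smulRight (EuclideanSpace.single l (1 : ℝ))

theorem paramDeriv_injective (c : EuclideanSpace ℝ {j // j ≠ l} →L[ℝ] ℝ) :
    Function.Injective (paramDeriv l c) := by
  intro y z h
  ext j
  have := congrArg (fun u : EuclideanSpace ℝ ι => u j) h
  simpa [paramDeriv, j.2] using this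

/-- The map is v ↦ (v, c v), which changes the inner product by the rank-one form c v · c w. -/
theorem normDet_paramDeriv (c : EuclideanSpace ℝ {j // j ≠ l} →L[ℝ] ℝ) :
    (paramDeriv l c : EuclideanSpace ℝ {j // j ≠ l} →ₗ[ℝ] EuclideanSpace ℝ ι).normDet =
      √(1 + ∑ j, c (EuclideanSpace.single j 1) ^ 2) := by
  rw [eq_comm, Real.sqrt_eq_iff_mul_self_eq (by positivity) (LinearMap.normDet_nonneg _), ← sq]
  rw [normDet_sq_of_inner_eq (EuclideanSpace.basisFun _ ℝ) (c := (c : _ →ₗ[ℝ] ℝ))]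
  · simp
  · intro v w
    have h1 := inner_coordHyperplane_single l v
    have h2 := inner_coordHyperplane_single l w
    simp only [paramDeriv, ContinuousLinearMap.coe_coe, add_apply,
      LinearIsometry.coe_toContinuousLinearMap, ContinuousLinearMap.smulRight_apply,
      inner_add_left, inner_add_right, inner_smul_left, inner_smul_right, h1,
      real_inner_comm _ (EuclideanSpace.single l (1 : ℝ)), h2, LinearIsometry.inner_map_map]
    simp [mul_comm]

theorem param_eq_updateCoord (a : ℝ) (y : EuclideanSpace ℝ {j // j ≠ l}) :
    param l C B a y = updateCoord l (coordHyperplane l y) (height l C B a y) :=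
  coordHyperplane_add_smul _ _ _

variable (hF : IsAffineInCoord l F C B)
include hF

theorem contDiff : ContDiff ℝ 1 F := by
  have : F = fun u => C u + B u * u l := funext hF.eq
  rw [this]
  have := hF.contDiff_left
  have := hF.contDiff_right
  fun_prop

/-- Where B ≠ 0, the equation C + B u_l = a has a unique solution u_l, as C and B do not depend on
u_l. -/
theorem image_param (a : ℝ) :
    param l C B a '' {y | B (coordHyperplane l y) ≠ 0} = F ⁻¹' {a} ∩ {u | B u ≠ 0} := by
  ext u
  constructor
  · rintro ⟨y, hy, rfl⟩
    have hy' : B (coordHyperplane l y) ≠ 0 := hy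
    rw [param_eq_updateCoord]
    refine ⟨?_, ?_⟩
    · simp only [Set.mem_preimage, Set.mem_singleton_iff, hF.eq, hF.left_update, hF.right_update,
        updateCoord_self, height]
      field_simp
      ring
    · simpa [hF.right_update] using hy'
  · rintro ⟨h1, h2⟩
    simp only [Set.mem_preimage, Set.mem_singleton_iff, Set.mem_ofPred_eq] at h1 h2
    refine ⟨WithLp.toLp 2 fun j : {j // j ≠ l} => u j, ?_, ?_⟩
    · rw [Set.mem_ofPred_eq, ← hF.right_update _ 0, updateCoord_coordHyperplane, hF.right_update]
      exact h2
    · rw [param_eq_updateCoord, updateCoord_coordHyperplane, height,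
        ← hF.right_update _ 0, ← hF.left_update _ 0, updateCoord_coordHyperplane, hF.right_update,
        hF.left_update]
      rw [← h1, hF.eq]
      convert updateCoord_eq_self l u using 2
      field_simp
      ring

theorem isOpen_domain : IsOpen {y | B (coordHyperplane l y) ≠ 0} :=
  isOpen_ne_fun (hF.contDiff_right.continuous.comp (coordHyperplane l).continuous)
    continuous_const

theorem contDiffOn_height (a : ℝ) :
    ContDiffOn ℝ 1 (height l C B a) {y | B (coordHyperplane l y) ≠ 0} := by
  have h1 : ContDiff ℝ 1 (coordHyperplane l) := (coordHyperplane l).toContinuousLinearMap.contDiff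
  exact ContDiffOn.div (contDiff_const.sub (hF.contDiff_left.comp h1)).contDiffOn
    (hF.contDiff_right.comp h1).contDiffOn fun y hy => hy

theorem hasStrictFDerivAt_param (a : ℝ) {y : EuclideanSpace ℝ {j // j ≠ l}}
    (hy : B (coordHyperplane l y) ≠ 0) :
    HasStrictFDerivAt (param l C B a) (paramDeriv l (fderiv ℝ (height l C B a) y)) y := by
  have h1 : HasStrictFDerivAt (height l C B a) (fderiv ℝ (height l C B a) y) y :=
    ((hF.contDiffOn_height a).contDiffAt (hF.isOpen_domain.mem_nhds hy)).hasStrictFDerivAt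
      (by norm_num)
  exact (coordHyperplane l).toContinuousLinearMap.hasStrictFDerivAt.add
    (h1.smul_const (EuclideanSpace.single l (1 : ℝ)))

theorem fderiv_single (u : EuclideanSpace ℝ ι) :
    fderiv ℝ F u (EuclideanSpace.single l 1) = B u := by
  have h1 : HasFDerivAt F (fderiv ℝ F u) u :=
    ((hF.contDiff.differentiable (by norm_num)) u).hasFDerivAt
  have h2 := h1.hasLineDerivAt (EuclideanSpace.single l (1 : ℝ))
  have h3 : ∀ t : ℝ, u + t • EuclideanSpace.single l (1 : ℝ) = updateCoord l u (u l + t) := by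
    intro t
    ext j
    by_cases h : j = l
    · subst h; simp
    · simp [updateCoord_of_ne h, h]
  have h4 : HasDerivAt (fun t : ℝ => C u + B u * (u l + t)) (B u) 0 := by
    simpa using (((hasDerivAt_id (0 : ℝ)).const_add (u l)).const_mul (B u)).const_add (C u)
  refine HasDerivAt.unique (f := fun t : ℝ => F (u + t • EuclideanSpace.single l (1 : ℝ))) h2 ?_
  refine h4.congr_of_eventuallyEq (Eventually.of_forall fun t => ?_)
  simp only [h3, hF.eq, hF.left_update, hF.right_update, updateCoord_self]

/-- With h the height function, differentiating the constant function F ∘ `param` gives ∂_j F = -B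
∂_j h for j ≠ l, while ∂_l F = B. Hence ‖∇F‖² = B²(1 + ‖∇h‖²), and the second factor is the squared
Jacobian of the graph. -/
theorem norm_gradient_param (a : ℝ) {y : EuclideanSpace ℝ {j // j ≠ l}}
    (hy : B (coordHyperplane l y) ≠ 0) :
    ‖gradient F (param l C B a y)‖ = |B (coordHyperplane l y)| *
      (paramDeriv l (fderiv ℝ (height l C B a) y) :
        EuclideanSpace ℝ {j // j ≠ l} →ₗ[ℝ] EuclideanSpace ℝ ι).normDet := by
  have hBy : B (param l C B a y) = B (coordHyperplane l y) := by
    rw [param_eq_updateCoord, hF.right_update]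
  have hconst : HasFDerivAt (fun z => F (param l C B a z))
      (0 : EuclideanSpace ℝ {j // j ≠ l} →L[ℝ] ℝ) y := by
    refine (hasFDerivAt_const a y).congr_of_eventuallyEq ?_
    filter_upwards [hF.isOpen_domain.mem_nhds hy] with z hz
    have := (hF.image_param a).subset (Set.mem_image_of_mem _ hz)
    exact this.1
  have hchain : HasFDerivAt (fun z => F (param l C B a z)) _ y :=
    (((hF.contDiff.differentiable (by norm_num)) (param l C B a y)).hasFDerivAt).comp y
      (hF.hasStrictFDerivAt_param a hy).hasFDerivAt
  have hpart : ∀ v, fderiv ℝ F (param l C B a y) (coordHyperplane l v) =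
      - (B (coordHyperplane l y) * fderiv ℝ (height l C B a) y v) := by
    intro v
    have h1 := congrArg (fun L : EuclideanSpace ℝ {j // j ≠ l} →L[ℝ] ℝ => L v)
      (hchain.unique hconst)
    simp only [ContinuousLinearMap.comp_apply, paramDeriv, add_apply,
      LinearIsometry.coe_toContinuousLinearMap, ContinuousLinearMap.smulRight_apply, map_add,
      map_smul, hF.fderiv_single, hBy, zero_apply, smul_eq_mul] at h1
    linarith
  rw [← sq_eq_sq₀ (norm_nonneg _) (mul_nonneg (abs_nonneg _) (LinearMap.normDet_nonneg _)),
    norm_gradient_sq, normDet_paramDeriv, mul_pow, sq_abs, Real.sq_sqrt (by positivity),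
    Fintype.sum_eq_add_sum_subtype_ne _ l, hF.fderiv_single, hBy, mul_add, mul_one,
    Finset.mul_sum]
  congr 1
  refine Finset.sum_congr rfl fun j _ => ?_
  rw [← coordHyperplane_single, hpart]
  ring

theorem continuousAt_normDet (a : ℝ) {y : EuclideanSpace ℝ {j // j ≠ l}}
    (hy : B (coordHyperplane l y) ≠ 0) :
    ContinuousAt (fun z => (paramDeriv l (fderiv ℝ (height l C B a) z) :
        EuclideanSpace ℝ {j // j ≠ l} →ₗ[ℝ] EuclideanSpace ℝ ι).normDet) y := by
  simp_rw [normDet_paramDeriv]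
  have h1 : ContinuousAt (fderiv ℝ (height l C B a)) y :=
    ((hF.contDiffOn_height a).continuousOn_fderiv_of_isOpen hF.isOpen_domain
      le_rfl).continuousAt (hF.isOpen_domain.mem_nhds hy)
  have h2 : ∀ j : {j // j ≠ l}, ContinuousAt
      (fun z => fderiv ℝ (height l C B a) z (EuclideanSpace.single j 1)) y := fun j =>
    h1.clm_apply continuousAt_const
  refine ContinuousAt.sqrt (continuousAt_const.add ?_)
  exact tendsto_finsetSum _ fun j _ => (h2 j).pow 2

end IsAffineInCoord

end Graph

/-! ### Level-set integrals in graph coordinates -/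

section GraphIntegral

open Module Topology Filter

variable {ι : Type*} [Fintype ι] [DecidableEq ι]

theorem measurable_prod_density {ι : Type*} [Fintype ι] {p : ι → ℝ → ℝ≥0∞} (hp : ∀ i, Measurable (p i)) :
    Measurable fun u : EuclideanSpace ℝ ι => ∏ i, p i (u i) :=
  Finset.measurable_prod _ fun i _ => (hp i).comp (by fun_prop)

theorem finrank_coordHyperplane (l : ι) :
    finrank ℝ (EuclideanSpace ℝ {j // j ≠ l}) = Fintype.card ι - 1 := by
  rw [finrank_euclideanSpace]
  simp [Fintype.card_subtype_compl]

theorem measurable_updateCoord (l : ι) {X : Type*} [MeasurableSpace X]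
    {f : X → EuclideanSpace ℝ ι} {g : X → ℝ} (hf : Measurable f) (hg : Measurable g) :
    Measurable fun x => updateCoord l (f x) (g x) := by
  refine (PiLp.volume_preserving_toLp ι).measurable.comp (measurable_pi_iff.2 fun j => ?_)
  by_cases h : j = l
  · subst h; simpa using hg
  · simp only [Function.update_of_ne h]
    fun_prop

/-- Integration over a coordinate hyperplane, with a dummy variable in the remaining coordinate. -/
theorem lintegral_coordHyperplane (l : ι) {p : ι → ℝ → ℝ≥0∞} (hp : ∀ i, Measurable (p i))
    [∀ i, IsProbabilityMeasure ((volume : Measure ℝ).withDensity (p i))]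
    {G : EuclideanSpace ℝ ι → ℝ≥0∞} (hG : Measurable G) :
    ∫⁻ y : EuclideanSpace ℝ {j // j ≠ l}, G (coordHyperplane l y) * ∏ j : {j // j ≠ l}, p j (y j) =
      ∫⁻ u : ι → ℝ, G (updateCoord l (WithLp.toLp 2 u) 0)
        ∂Measure.pi fun i => (volume : Measure ℝ).withDensity (p i) := by
  set ν : ι → Measure ℝ := fun i => (volume : Measure ℝ).withDensity (p i) with hν
  have hmp := measurePreserving_piEquivPiSubtypeProd ν (fun j => j = l)
  have h1 : (fun u : ι → ℝ => G (updateCoord l (WithLp.toLp 2 u) 0)) = fun u =>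
      (fun z : ({j // j = l} → ℝ) × ({j // ¬ j = l} → ℝ) =>
        G (coordHyperplane l (WithLp.toLp 2 z.2)))
        (MeasurableEquiv.piEquivPiSubtypeProd (fun _ => ℝ) (fun j => j = l) u) := by
    ext u
    have h2 := updateCoord_eq_self l
      (coordHyperplane l (WithLp.toLp 2 fun j : {j // j ≠ l} => (WithLp.toLp 2 u) j))
    rw [coordHyperplane_self] at h2
    rw [← updateCoord_coordHyperplane, h2]
    rfl
  have hm : Measurable fun y : {j // ¬ j = l} → ℝ => G (coordHyperplane l (WithLp.toLp 2 y)) :=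
    hG.comp ((coordHyperplane l).continuous.measurable.comp
      (PiLp.volume_preserving_toLp _).measurable)
  rw [h1, hmp.lintegral_comp_emb (MeasurableEquiv.measurableEmbedding _)
    (fun z : ({j // j = l} → ℝ) × ({j // ¬ j = l} → ℝ) =>
      G (coordHyperplane l (WithLp.toLp 2 z.2)))]
  refine Eq.trans ?_ (lintegral_prod (fun z : ({j // j = l} → ℝ) × ({j // ¬ j = l} → ℝ) =>
      G (coordHyperplane l (WithLp.toLp 2 z.2))) (hm.comp measurable_snd).aemeasurable).symm
  -- The integrand ignores coordinate l, whose law has total mass 1.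
  simp only [lintegral_const, measure_univ, mul_one]
  have h2 : (Measure.pi fun i : {j // ¬ j = l} => ν i) =
      (volume : Measure ({j // ¬ j = l} → ℝ)).withDensity fun y => ∏ j : {j // ¬ j = l}, p j (y j) :=
    pi_withDensity (p := fun j : {j // ¬ j = l} => p j) fun j => hp j
  have hpm : Measurable fun y : {j // ¬ j = l} → ℝ => ∏ j : {j // ¬ j = l}, p j (y j) :=
    Finset.measurable_prod _ fun j _ => (hp j).comp (measurable_pi_apply j)
  rw [h2, lintegral_withDensity_eq_lintegral_mul _ hpm hm]
  rw [← (PiLp.volume_preserving_toLp {j // j ≠ l}).lintegral_comp_emb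
    (MeasurableEquiv.toLp 2 ({j // j ≠ l} → ℝ)).measurableEmbedding]
  refine lintegral_congr fun y => ?_
  simp [mul_comm]

open IsAffineInCoord in
theorem IsAffineInCoord.prod_density_param {C B : EuclideanSpace ℝ ι → ℝ} (p : ι → ℝ → ℝ≥0∞) (a : ℝ) {l : ι} (y : EuclideanSpace ℝ {j // j ≠ l}) :
    ∏ i, p i (param l C B a y i) =
      p l (height l C B a y) * ∏ j : {j // j ≠ l}, p j (y j) := by
  rw [Fintype.prod_eq_mul_prod_subtype_ne _ l, param_eq_updateCoord, updateCoord_self]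
  congr 1
  refine Finset.prod_congr rfl fun j _ => ?_
  rw [updateCoord_of_ne j.2, coordHyperplane_coe]

namespace IsAffineInCoord

variable {l : ι} {F C B : EuclideanSpace ℝ ι → ℝ} (hF : IsAffineInCoord l F C B)
include hF

theorem measurable_height (a : ℝ) : Measurable (height l C B a) :=
  (measurable_const.sub (hF.contDiff_left.continuous.comp
    (coordHyperplane l).continuous).measurable).div
    (hF.contDiff_right.continuous.comp (coordHyperplane l).continuous).measurable

theorem measurable_param (a : ℝ) : Measurable (param l C B a) :=
  (coordHyperplane l).continuous.measurable.add ((hF.measurable_height a).smul_const _)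

theorem levelVolume_restrict_apply (a : ℝ) {t : Set (EuclideanSpace ℝ ι)} (ht : MeasurableSet t) :
    ((levelVolume F a).restrict {u | B u ≠ 0}) t =
      μHE[finrank ℝ (EuclideanSpace ℝ {j // j ≠ l})] (param l C B a ''
        (param l C B a ⁻¹' t ∩ {y | B (coordHyperplane l y) ≠ 0})) := by
  have hB : MeasurableSet {u | B u ≠ 0} :=
    (isOpen_ne_fun hF.contDiff_right.continuous continuous_const).measurableSet
  rw [Measure.restrict_apply ht, levelVolume, Measure.restrict_apply (ht.inter hB),
    finrank_coordHyperplane, Set.image_preimage_inter, hF.image_param]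
  congr 1
  ext u
  simp only [Set.mem_inter_iff]
  tauto

/-- The Jacobian cancels pointwise against ‖∇F‖, which is |B| times the Jacobian. -/
theorem lintegral_jacobian_eq (a : ℝ) (Z : EuclideanSpace ℝ ι → ℝ≥0∞) :
    ∫⁻ y in {y | B (coordHyperplane l y) ≠ 0},
      ENNReal.ofReal (paramDeriv l (fderiv ℝ (height l C B a) y) :
        EuclideanSpace ℝ {j // j ≠ l} →ₗ[ℝ] EuclideanSpace ℝ ι).normDet *
        (Z (param l C B a y) / ENNReal.ofReal ‖gradient F (param l C B a y)‖) =
    ∫⁻ y in {y | B (coordHyperplane l y) ≠ 0},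
      Z (param l C B a y) / ENNReal.ofReal |B (coordHyperplane l y)| := by
  refine setLIntegral_congr_fun hF.isOpen_domain.measurableSet fun y hy => ?_
  have hJ : 0 < (paramDeriv l (fderiv ℝ (height l C B a) y) :
      EuclideanSpace ℝ {j // j ≠ l} →ₗ[ℝ] EuclideanSpace ℝ ι).normDet := by
    rw [normDet_paramDeriv]
    positivity
  rw [hF.norm_gradient_param a hy, ENNReal.ofReal_mul (abs_nonneg _), div_eq_mul_inv,
    div_eq_mul_inv, ENNReal.mul_inv (Or.inr ENNReal.ofReal_ne_top) (Or.inl ENNReal.ofReal_ne_top),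
    mul_left_comm, mul_left_comm (ENNReal.ofReal _),
    ENNReal.mul_inv_cancel (ENNReal.ofReal_pos.2 hJ).ne' ENNReal.ofReal_ne_top, mul_one]

/-- The integral over the level set `F = a` is bounded by the integral in the graph coordinates. -/
theorem lintegral_levelVolume_le (a : ℝ) {Z : EuclideanSpace ℝ ι → ℝ≥0∞} (hZ : Measurable Z) :
    ∫⁻ u in {u | B u ≠ 0}, Z u / ENNReal.ofReal ‖gradient F u‖ ∂levelVolume F a ≤
      ∫⁻ y in {y | B (coordHyperplane l y) ≠ 0},
        Z (param l C B a y) / ENNReal.ofReal |B (coordHyperplane l y)| := by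
  set J : EuclideanSpace ℝ {j // j ≠ l} → ℝ≥0∞ := fun y =>
    ENNReal.ofReal (paramDeriv l (fderiv ℝ (height l C B a) y) :
      EuclideanSpace ℝ {j // j ≠ l} →ₗ[ℝ] EuclideanSpace ℝ ι).normDet with hJ
  have hΩ := hF.isOpen_domain.measurableSet
  have hJm : Measurable J := by
    have : Measurable fun y => √(1 + ∑ j, fderiv ℝ (height l C B a) y
        (EuclideanSpace.single j 1) ^ 2) := by
      refine (measurable_const.add (Finset.measurable_sum _ fun j _ => ?_)).sqrt
      exact (measurable_fderiv_apply_const ℝ (height l C B a) _).pow_const 2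
    simp only [hJ, normDet_paramDeriv]
    exact this.ennreal_ofReal
  -- It is enough to compare measures: on each measurable set this is the area inequality for the
  -- graph parametrization.
  have hle : (levelVolume F a).restrict {u | B u ≠ 0} ≤
      ((volume.restrict {y | B (coordHyperplane l y) ≠ 0}).withDensity J).map
        (param l C B a) := by
    refine Measure.le_iff.2 fun t ht => ?_
    have hpt := (hF.measurable_param a) ht
    rw [Measure.map_apply (hF.measurable_param a) ht, withDensity_apply _ hpt,
      Measure.restrict_restrict hpt, hF.levelVolume_restrict_apply a ht]
    exact euclideanHausdorffMeasure_image_le_lintegral (hpt.inter hΩ)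
      (fun y hy => hF.hasStrictFDerivAt_param a hy.2) (fun y _ => paramDeriv_injective _)
      (fun y hy => hF.continuousAt_normDet a hy.2)
  have hgm : Measurable fun u => Z u / ENNReal.ofReal ‖gradient F u‖ := by
    refine hZ.div (Measurable.ennreal_ofReal (Measurable.norm ?_))
    exact (LinearIsometryEquiv.continuous _).measurable.comp (measurable_fderiv ℝ F)
  refine (lintegral_mono' hle le_rfl).trans ?_
  rw [lintegral_map hgm (hF.measurable_param a)]
  refine (lintegral_withDensity_eq_lintegral_mul _ hJm
    (hgm.comp (hF.measurable_param a))).trans_le ?_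
  exact (hF.lintegral_jacobian_eq a Z).le

/-- For affine functions, the integral over the level set `F = a` is at least the integral in the
graph coordinates. -/
theorem le_lintegral_levelVolume (a : ℝ) {Z : EuclideanSpace ℝ ι → ℝ≥0∞} (hZ : Measurable Z)
    (hB : ∀ u, B u ≠ 0) {b : ℝ} {c : EuclideanSpace ℝ {j // j ≠ l} →L[ℝ] ℝ}
    (hh : ∀ y, height l C B a y = b + c y) :
    ∫⁻ y, Z (param l C B a y) / ENNReal.ofReal |B (coordHyperplane l y)| ≤
      ∫⁻ u, Z u / ENNReal.ofReal ‖gradient F u‖ ∂levelVolume F a := by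
  have hΩ : {y : EuclideanSpace ℝ {j // j ≠ l} | B (coordHyperplane l y) ≠ 0} = Set.univ :=
    Set.eq_univ_of_forall fun y => hB _
  have hΩ' : {u | B u ≠ 0} = Set.univ := Set.eq_univ_of_forall hB
  have hc : ∀ y, fderiv ℝ (height l C B a) y = c := by
    intro y
    rw [show height l C B a = fun y => b + c y from funext hh, fderiv_const_add]
    exact c.fderiv
  have hparam : param l C B a = fun y => b • EuclideanSpace.single l (1 : ℝ) +
      paramDeriv l c y := by
    ext1 y
    simp only [param, hh, paramDeriv, add_apply, LinearIsometry.coe_toContinuousLinearMap,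
      ContinuousLinearMap.smulRight_apply, add_smul]
    abel
  have hJ := hF.lintegral_jacobian_eq a Z
  simp only [hΩ, Measure.restrict_univ, hc] at hJ
  -- The parametrization is affine with constant Jacobian, so the two sides agree on every
  -- measurable set.
  have hle : (volume.withDensity fun _ => ENNReal.ofReal
      (paramDeriv l c : EuclideanSpace ℝ {j // j ≠ l} →ₗ[ℝ] EuclideanSpace ℝ ι).normDet).map
        (param l C B a) ≤ levelVolume F a := by
    refine Measure.le_iff.2 fun t ht => ?_
    have hpt := (hF.measurable_param a) ht
    have h1 := hF.levelVolume_restrict_apply a ht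
    rw [hΩ', Measure.restrict_univ, hΩ, Set.inter_univ] at h1
    rw [Measure.map_apply (hF.measurable_param a) ht, withDensity_apply _ hpt, h1,
      setLIntegral_const]
    conv_rhs => rw [hparam]
    rw [euclideanHausdorffMeasure_affine_image, ← hparam]
  have hgm : Measurable fun u => Z u / ENNReal.ofReal ‖gradient F u‖ := by
    refine hZ.div (Measurable.ennreal_ofReal (Measurable.norm ?_))
    exact (LinearIsometryEquiv.continuous _).measurable.comp (measurable_fderiv ℝ F)
  refine le_trans ?_ (lintegral_mono' hle le_rfl)
  rw [lintegral_map hgm (hF.measurable_param a)]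
  refine le_trans ?_ (lintegral_withDensity_eq_lintegral_mul _ measurable_const
    (hgm.comp (hF.measurable_param a))).ge
  exact hJ.ge

/-- The integrand in graph coordinates, as a function on the whole space that does not depend on
the coordinate `l`. -/
theorem lintegral_param (a : ℝ) {p : ι → ℝ → ℝ≥0∞} (hp : ∀ i, Measurable (p i))
    [∀ i, IsProbabilityMeasure ((volume : Measure ℝ).withDensity (p i))]
    {Z : EuclideanSpace ℝ ι → ℝ≥0∞} (hZ : Measurable Z) :
    ∫⁻ y in {y | B (coordHyperplane l y) ≠ 0},
      Z (param l C B a y) * (∏ i, p i (param l C B a y i)) /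
        ENNReal.ofReal |B (coordHyperplane l y)| =
    ∫⁻ u in {u : ι → ℝ | B (WithLp.toLp 2 u) ≠ 0},
      Z (updateCoord l (WithLp.toLp 2 u) ((a - C (WithLp.toLp 2 u)) / B (WithLp.toLp 2 u))) *
        p l ((a - C (WithLp.toLp 2 u)) / B (WithLp.toLp 2 u)) /
        ENNReal.ofReal |B (WithLp.toLp 2 u)|
      ∂Measure.pi fun i => (volume : Measure ℝ).withDensity (p i) := by
  have hBm : Measurable B := hF.contDiff_right.continuous.measurable
  have hhm : Measurable fun w => (a - C w) / B w :=
    (measurable_const.sub hF.contDiff_left.continuous.measurable).div hBm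
  have hS : MeasurableSet {w | B w ≠ 0} :=
    (isOpen_ne_fun hF.contDiff_right.continuous continuous_const).measurableSet
  set G : EuclideanSpace ℝ ι → ℝ≥0∞ := {w | B w ≠ 0}.indicator fun w =>
    Z (updateCoord l w ((a - C w) / B w)) * p l ((a - C w) / B w) / ENNReal.ofReal |B w| with hG
  have hGm : Measurable G := by
    refine Measurable.indicator ?_ hS
    refine ((hZ.comp (measurable_updateCoord l measurable_id hhm)).mul ((hp l).comp hhm)).div ?_
    exact (measurable_norm.comp hBm).ennreal_ofReal
  -- G sees coordinate l only through the value substituted for it, so that coordinate can be kept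
  -- as a dummy variable.
  have hGu : ∀ u t, G (updateCoord l u t) = G u := by
    intro u t
    have h1 : ∀ s, updateCoord l (updateCoord l u t) s = updateCoord l u s := fun s => by
      simp [updateCoord]
    simp only [hG, Set.indicator, Set.mem_ofPred_eq, hF.right_update, hF.left_update, h1]
    congr
  have h := lintegral_coordHyperplane l hp hGm
  simp only [hGu] at h
  have hS' : MeasurableSet {u : ι → ℝ | B (WithLp.toLp 2 u) ≠ 0} :=
    (PiLp.volume_preserving_toLp ι).measurable hS
  rw [← lintegral_indicator hF.isOpen_domain.measurableSet, ← lintegral_indicator hS']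
  refine Eq.trans (lintegral_congr fun y => ?_) (h.trans (lintegral_congr fun u => ?_))
  · by_cases hy : B (coordHyperplane l y) ≠ 0
    · rw [Set.indicator_of_mem hy, hG, Set.indicator_of_mem hy, prod_density_param,
        param_eq_updateCoord, height]
      simp only [div_eq_mul_inv]
      ring
    · rw [Set.indicator_of_notMem hy, hG, Set.indicator_of_notMem hy, zero_mul]
  · by_cases hu : B (WithLp.toLp 2 u) ≠ 0
    · rw [Set.indicator_of_mem hu, hG, Set.indicator_of_mem hu]
    · rw [Set.indicator_of_notMem hu, hG, Set.indicator_of_notMem hu]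

/-- Coordinate l is determined by the others on the level set and contributes its density divided by
|B|; the others keep their law. The locus B = 0 is not covered by the graph and has to be treated
separately in each application. -/
theorem condExpMulDensity_le (a : ℝ) {p : ι → ℝ → ℝ≥0∞} (hp : ∀ i, Measurable (p i))
    [∀ i, IsProbabilityMeasure ((volume : Measure ℝ).withDensity (p i))]
    {Z : EuclideanSpace ℝ ι → ℝ≥0∞} (hZ : Measurable Z) :
    ∫⁻ u in {u | B u ≠ 0}, Z u * ((∏ i, p i (u i)) / ENNReal.ofReal ‖gradient F u‖)
      ∂levelVolume F a ≤
    ∫⁻ u in {u : ι → ℝ | B (WithLp.toLp 2 u) ≠ 0},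
      Z (updateCoord l (WithLp.toLp 2 u) ((a - C (WithLp.toLp 2 u)) / B (WithLp.toLp 2 u))) *
        p l ((a - C (WithLp.toLp 2 u)) / B (WithLp.toLp 2 u)) /
        ENNReal.ofReal |B (WithLp.toLp 2 u)|
      ∂Measure.pi fun i => (volume : Measure ℝ).withDensity (p i) := by
  rw [← hF.lintegral_param a hp hZ]
  simp only [← mul_div_assoc]
  exact hF.lintegral_levelVolume_le a (hZ.mul (measurable_prod_density hp))

theorem le_condExpMulDensity (a : ℝ) {p : ι → ℝ → ℝ≥0∞} (hp : ∀ i, Measurable (p i))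
    [∀ i, IsProbabilityMeasure ((volume : Measure ℝ).withDensity (p i))]
    {Z : EuclideanSpace ℝ ι → ℝ≥0∞} (hZ : Measurable Z) (hB : ∀ u, B u ≠ 0) {b : ℝ}
    {c : EuclideanSpace ℝ {j // j ≠ l} →L[ℝ] ℝ} (hh : ∀ y, height l C B a y = b + c y) :
    ∫⁻ u : ι → ℝ,
      Z (updateCoord l (WithLp.toLp 2 u) ((a - C (WithLp.toLp 2 u)) / B (WithLp.toLp 2 u))) *
        p l ((a - C (WithLp.toLp 2 u)) / B (WithLp.toLp 2 u)) /
        ENNReal.ofReal |B (WithLp.toLp 2 u)|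
      ∂Measure.pi (fun i => (volume : Measure ℝ).withDensity (p i)) ≤
    condExpMulDensity (fun u => ∏ i, p i (u i)) F Z a := by
  have h := hF.lintegral_param a hp hZ
  simp only [hB, ne_eq, not_false_eq_true, Set.ofPred_true, Measure.restrict_univ] at h
  rw [← h, condExpMulDensity]
  simp only [← mul_div_assoc]
  exact hF.le_lintegral_levelVolume a (hZ.mul (measurable_prod_density hp)) hB hh

end IsAffineInCoord

end GraphIntegral

end

/-! ### Standard Gaussian estimates and laws of linear forms -/

section StandardGaussian

theorem withDensity_gaussianPDF :
    (volume : Measure ℝ).withDensity (gaussianPDF 0 1) = gaussianReal 0 1 :=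
  (gaussianReal_of_var_ne_zero 0 one_ne_zero).symm

instance isProbabilityMeasure_withDensity_gaussianPDF :
    IsProbabilityMeasure ((volume : Measure ℝ).withDensity (gaussianPDF 0 1)) := by
  rw [withDensity_gaussianPDF]
  infer_instance

theorem gaussianPDF_std (t : ℝ) :
    gaussianPDF 0 1 t = ENNReal.ofReal ((√(2 * Real.pi))⁻¹ * Real.exp (-t ^ 2 / 2)) := by
  simp [gaussianPDF, gaussianPDFReal]

theorem gaussianPDF_std_le (t : ℝ) :
    gaussianPDF 0 1 t ≤ ENNReal.ofReal (√(2 * Real.pi))⁻¹ := by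
  rw [gaussianPDF_std]
  refine ENNReal.ofReal_le_ofReal (mul_le_of_le_one_right (by positivity) ?_)
  rw [Real.exp_le_one_iff]
  nlinarith [sq_nonneg t]

/-- Indeed |t| ≤ 1 + t²/2 ≤ exp(t²/2), and 2π ≥ 1. -/
theorem abs_mul_gaussianPDF_std_le_one (t : ℝ) :
    ENNReal.ofReal |t| * gaussianPDF 0 1 t ≤ 1 := by
  rw [gaussianPDF_std, ← ENNReal.ofReal_mul (abs_nonneg _), ← ENNReal.ofReal_one]
  refine ENNReal.ofReal_le_ofReal ?_
  have h1 : (√(2 * Real.pi))⁻¹ ≤ 1 := by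
    refine inv_le_one_of_one_le₀ (Real.one_le_sqrt.2 ?_)
    nlinarith [Real.pi_gt_three]
  have h2 : |t| ≤ Real.exp (t ^ 2 / 2) := by
    have := Real.add_one_le_exp (t ^ 2 / 2)
    nlinarith [sq_nonneg (|t| - 1), sq_abs t]
  have h3 : |t| * Real.exp (-t ^ 2 / 2) ≤ 1 := by
    calc |t| * Real.exp (-t ^ 2 / 2) ≤ Real.exp (t ^ 2 / 2) * Real.exp (-t ^ 2 / 2) := by gcongr
      _ = 1 := by rw [← Real.exp_add]; ring_nf; exact Real.exp_zero
  calc |t| * ((√(2 * Real.pi))⁻¹ * Real.exp (-t ^ 2 / 2))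
      = (√(2 * Real.pi))⁻¹ * (|t| * Real.exp (-t ^ 2 / 2)) := by ring
    _ ≤ 1 * 1 := by gcongr
    _ = 1 := one_mul 1

/-- Integrate |t| ≤ (1 + t²)/2 and use that the variance is 1. -/
theorem lintegral_abs_gaussianReal_le_one :
    ∫⁻ t, ENNReal.ofReal |t| ∂gaussianReal 0 1 ≤ 1 := by
  have hm : MemLp (fun t : ℝ => t) 2 (gaussianReal 0 1) := memLp_id_gaussianReal 2
  have hvar : ∫ t, t ^ 2 ∂gaussianReal 0 1 = 1 := by
    have h1 := variance_fun_id_gaussianReal (μ := 0) (v := 1)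
    rw [variance_of_integral_eq_zero aemeasurable_id' integral_id_gaussianReal] at h1
    simpa using h1
  have hint : Integrable (fun t : ℝ => (1 + t ^ 2) / 2) (gaussianReal 0 1) :=
    ((integrable_const 1).add hm.integrable_sq).div_const 2
  calc ∫⁻ t, ENNReal.ofReal |t| ∂gaussianReal 0 1
      ≤ ∫⁻ t, ENNReal.ofReal ((1 + t ^ 2) / 2) ∂gaussianReal 0 1 := by
        refine lintegral_mono fun t => ENNReal.ofReal_le_ofReal ?_
        nlinarith [sq_nonneg (|t| - 1), sq_abs t]
    _ = ENNReal.ofReal (∫ t, (1 + t ^ 2) / 2 ∂gaussianReal 0 1) :=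
        (ofReal_integral_eq_lintegral_ofReal hint (Filter.Eventually.of_forall fun t => by
          positivity)).symm
    _ = 1 := by
        rw [integral_div, integral_add (integrable_const 1) hm.integrable_sq, hvar]
        norm_num
    _ ≤ 1 := le_rfl

theorem lintegral_gaussianReal {f : ℝ → ℝ≥0∞} (hf : Measurable f) :
    ∫⁻ t, f t ∂gaussianReal 0 1 = ∫⁻ t, gaussianPDF 0 1 t * f t := by
  rw [← withDensity_gaussianPDF,
    lintegral_withDensity_eq_lintegral_mul _ (measurable_gaussianPDF 0 1) hf]
  rfl

theorem ofReal_abs_mul_lintegral_comp_mul_left {c : ℝ} (hc : c ≠ 0) {f : ℝ → ℝ≥0∞}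
    (hf : Measurable f) : ENNReal.ofReal |c| * ∫⁻ t, f (c * t) = ∫⁻ t, f t := by
  conv_rhs => rw [← Real.smul_map_volume_mul_left hc]
  rw [lintegral_smul_measure, lintegral_map hf (measurable_const_mul c), smul_eq_mul]

/-- A linear form in independent standard Gaussians is Gaussian. -/
theorem map_sum_pi_gaussianReal {σ : Type*} [Fintype σ] (c : σ → ℝ) :
    (Measure.pi fun _ : σ => gaussianReal 0 1).map (fun u => ∑ s, c s * u s) =
      (gaussianReal 0 1).map (fun t => √(∑ s, c s ^ 2) * t) := by
  rw [gaussianReal_map_const_mul]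
  have hm : Measurable fun u : σ → ℝ => ∑ s, c s * u s := by fun_prop
  refine Measure.ext_of_charFun (funext fun t => ?_)
  rw [charFun_gaussianReal, charFun_apply, integral_map hm.aemeasurable (by fun_prop)]
  have h1 : ∀ u : σ → ℝ, Complex.exp (↑(inner ℝ (∑ s, c s * u s) t) * Complex.I) =
      ∏ s, Complex.exp (↑(inner ℝ (u s) (t * c s)) * Complex.I) := by
    intro u
    rw [← Complex.exp_sum, ← Finset.sum_mul]
    congr 2
    simp only [RCLike.inner_apply, conj_trivial]
    push_cast
    rw [Finset.mul_sum]
    exact Finset.sum_congr rfl fun s _ => by ring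
  simp_rw [h1]
  rw [integral_fintype_prod_eq_prod (fun (s : σ) (y : ℝ) =>
    Complex.exp (↑(inner ℝ y (t * c s)) * Complex.I))]
  simp_rw [← charFun_apply, charFun_gaussianReal]
  rw [← Complex.exp_sum]
  congr 1
  have h2 : ((√(∑ s, c s ^ 2) ^ 2 : ℝ) : ℂ) = ∑ s, (c s : ℂ) ^ 2 := by
    rw [Real.sq_sqrt (Finset.sum_nonneg fun s _ => sq_nonneg _)]
    push_cast
    rfl
  push_cast at h2
  simp only [Complex.ofReal_mul, Complex.ofReal_zero, mul_zero, zero_mul, NNReal.coe_one,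
    Complex.ofReal_one, one_mul, zero_sub, Finset.sum_neg_distrib, neg_inj,
    NNReal.coe_mk, mul_one]
  push_cast
  rw [h2, Finset.sum_mul, Finset.sum_div]
  exact Finset.sum_congr rfl fun s _ => by ring

/-- The density of `r t + s` for independent standard Gaussians `s`, `t`. -/
theorem lintegral_gaussianPDF_sub (b r : ℝ) :
    ∫⁻ t, gaussianPDF 0 1 (b - r * t) ∂gaussianReal 0 1 =
      (ENNReal.ofReal √(1 + r ^ 2))⁻¹ * gaussianPDF 0 1 (b / √(1 + r ^ 2)) := by
  have hpos : 0 < 1 + r ^ 2 := by positivity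
  set s := √(1 + r ^ 2) with hs
  have hs0 : 0 < s := Real.sqrt_pos.2 hpos
  have hs2 : s ^ 2 = 1 + r ^ 2 := Real.sq_sqrt hpos.le
  have hm : Measurable fun t => gaussianPDF 0 1 (b - r * t) :=
    (measurable_gaussianPDF 0 1).comp (by fun_prop)
  -- Completing the square: t² + (b - r t)² = (b/s)² + (s t - b r/s)² with s² = 1 + r².
  have hpt : ∀ t, gaussianPDF 0 1 t * gaussianPDF 0 1 (b - r * t) =
      gaussianPDF 0 1 (b / s) * gaussianPDF 0 1 (s * t + -(b * r / s)) := by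
    intro t
    simp only [gaussianPDF_std]
    rw [← ENNReal.ofReal_mul (by positivity), ← ENNReal.ofReal_mul (by positivity)]
    congr 1
    have h1 : ∀ p q : ℝ, (√(2 * Real.pi))⁻¹ * Real.exp p * ((√(2 * Real.pi))⁻¹ * Real.exp q) =
        (√(2 * Real.pi))⁻¹ * (√(2 * Real.pi))⁻¹ * Real.exp (p + q) := fun p q => by
      rw [Real.exp_add]
      ring
    rw [h1, h1]
    congr 2
    have hb : b = b / s * s := by field_simp
    have hbr : b * r / s = b / s * r := by ring
    rw [hbr]
    generalize b / s = w at hb ⊢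
    subst hb
    linear_combination (t ^ 2 - w ^ 2) / 2 * hs2
  rw [lintegral_gaussianReal hm, lintegral_congr hpt, lintegral_const_mul _ (by fun_prop)]
  have h1 := ofReal_abs_mul_lintegral_comp_mul_left hs0.ne'
    (f := fun t => gaussianPDF 0 1 (t + -(b * r / s))) (by fun_prop)
  rw [lintegral_add_right_eq_self (fun t => gaussianPDF 0 1 t),
    lintegral_gaussianPDF_eq_one 0 one_ne_zero, abs_of_pos hs0] at h1
  rw [ENNReal.eq_inv_of_mul_eq_one_left ((mul_comm _ _).trans h1), mul_comm]

end StandardGaussian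

/-! ### The density of a product of Gaussians -/

section ProductDensity

theorem measurable_gaussianProdDensity (k : ℕ) : Measurable (gaussianProdDensity k) := by
  unfold gaussianProdDensity
  refine Measurable.lintegral_prod_right' (f := fun z : ℝ × (Fin (k - 1) → ℝ) =>
    gaussianPDF 0 1 (z.1 / ∏ j, z.2 j) *
    ∏ j, (gaussianPDF 0 1 (z.2 j) / ENNReal.ofReal |z.2 j|)) ?_
  refine Measurable.mul ?_ (Finset.measurable_prod _ fun j _ => ?_)
  · exact (measurable_gaussianPDF 0 1).comp (measurable_fst.div
      (Finset.measurable_prod _ fun j _ => (measurable_pi_apply j).comp measurable_snd))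
  · exact ((measurable_gaussianPDF 0 1).comp ((measurable_pi_apply j).comp measurable_snd)).div
      (measurable_norm.comp ((measurable_pi_apply j).comp measurable_snd)).ennreal_ofReal

@[fun_prop]
theorem measurable_gaussianPDF_comp {X : Type*} [MeasurableSpace X] {f : X → ℝ}
    (hf : Measurable f) : Measurable fun x => gaussianPDF 0 1 (f x) :=
  (measurable_gaussianPDF 0 1).comp hf

theorem measurable_gaussianPDF_div_prod {X : Type*} [MeasurableSpace X] {n : ℕ} {f : X → ℝ}
    {g : X → Fin n → ℝ} (hf : Measurable f) (hg : Measurable g) :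
    Measurable fun x => gaussianPDF 0 1 (f x / ∏ j, g x j) / ENNReal.ofReal |∏ j, g x j| := by
  have h : Measurable fun x => ∏ j, g x j := by fun_prop
  exact (measurable_gaussianPDF_comp (hf.div h)).div (measurable_norm.comp h).ennreal_ofReal

/-- Reading ϖ_k as a Gaussian expectation over the last k - 1 factors turns pointwise estimates for
φ into estimates for ϖ_k. -/
theorem gaussianProdDensity_eq_lintegral_pi (k : ℕ) (a : ℝ) :
    gaussianProdDensity k a = ∫⁻ y : Fin (k - 1) → ℝ,
      gaussianPDF 0 1 (a / ∏ j, y j) / ENNReal.ofReal |∏ j, y j|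
        ∂Measure.pi fun _ => gaussianReal 0 1 := by
  simp_rw [← withDensity_gaussianPDF]
  rw [pi_withDensity (fun _ => measurable_gaussianPDF 0 1)]
  have hm : Measurable fun y : Fin (k - 1) → ℝ =>
      gaussianPDF 0 1 (a / ∏ j, y j) / ENNReal.ofReal |∏ j, y j| :=
    measurable_gaussianPDF_div_prod measurable_const measurable_id
  have hp : Measurable fun y : Fin (k - 1) → ℝ => ∏ j, gaussianPDF 0 1 (y j) := by
    fun_prop
  rw [lintegral_withDensity_eq_lintegral_mul _ hp hm, gaussianProdDensity]
  refine lintegral_congr fun y => ?_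
  simp only [Pi.mul_apply, div_eq_mul_inv]
  rw [Finset.prod_mul_distrib, Finset.abs_prod, ENNReal.ofReal_prod_of_nonneg
    (fun j _ => abs_nonneg _), ENNReal.prod_inv_distrib]
  · ring
  · exact fun i _ j _ _ => Or.inr ENNReal.ofReal_ne_top

theorem ae_prod_ne_zero {n : ℕ} :
    ∀ᵐ y : Fin n → ℝ ∂Measure.pi fun _ => gaussianReal 0 1, ∏ j, y j ≠ 0 := by
  simp only [Finset.prod_ne_zero_iff, Finset.mem_univ, true_imp_iff]
  refine ae_all_iff.2 fun j => ?_
  have : NullSingletonClass (gaussianReal 0 1) := nullSingletonClass_gaussianReal one_ne_zero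
  exact (measurePreserving_eval (fun _ : Fin n => gaussianReal 0 1) j).quasiMeasurePreserving.ae
    (p := fun t => t ≠ 0) (Measure.ae_ne (gaussianReal 0 1) 0)

/-- `ϖ_k` is the density of the product of `k` independent standard Gaussians. -/
theorem map_prod_pi_gaussianReal {k : ℕ} (hk : 1 ≤ k) :
    (Measure.pi fun _ : Fin k => gaussianReal 0 1).map (fun y => ∏ j, y j) =
      (volume : Measure ℝ).withDensity (gaussianProdDensity k) := by
  obtain ⟨n, rfl⟩ : ∃ n, k = n + 1 := ⟨k - 1, by omega⟩
  refine Measure.ext_of_lintegral _ fun g hg => ?_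
  have hprod : ∀ n : ℕ, Measurable fun y : Fin n → ℝ => ∏ j, y j := fun n =>
    Finset.measurable_prod _ fun j _ => measurable_pi_apply j
  rw [lintegral_map hg (hprod _), lintegral_withDensity_eq_lintegral_mul _
    (measurable_gaussianProdDensity _) hg]
  have hmp := measurePreserving_piFinSuccAbove (fun _ : Fin (n + 1) => gaussianReal 0 1) 0
  have h1 : (fun y : Fin (n + 1) → ℝ => g (∏ j, y j)) = fun y =>
      (fun z : ℝ × (Fin n → ℝ) => g (z.1 * ∏ j, z.2 j))
        (MeasurableEquiv.piFinSuccAbove (fun _ => ℝ) 0 y) := by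
    ext y
    simp [Fin.prod_univ_succ, MeasurableEquiv.piFinSuccAbove, Fin.tail]
  have hm : Measurable fun z : ℝ × (Fin n → ℝ) => g (z.1 * ∏ j, z.2 j) :=
    hg.comp (measurable_fst.mul ((hprod n).comp measurable_snd))
  rw [h1, hmp.lintegral_comp_emb (MeasurableEquiv.measurableEmbedding _)
    (fun z : ℝ × (Fin n → ℝ) => g (z.1 * ∏ j, z.2 j))]
  refine (lintegral_prod_symm' _ hm).trans ?_
  -- With the other factors fixed and nonzero, substitute v = t ∏ y_j.
  have h2 : ∀ᵐ y : Fin n → ℝ ∂Measure.pi fun _ => gaussianReal 0 1,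
      ∫⁻ t, g (t * ∏ j, y j) ∂gaussianReal 0 1 =
      ∫⁻ v, g v * (gaussianPDF 0 1 (v / ∏ j, y j) / ENNReal.ofReal |∏ j, y j|) := by
    filter_upwards [ae_prod_ne_zero] with y hy
    rw [lintegral_gaussianReal (f := fun t => g (t * ∏ j, y j)) (hg.comp (measurable_mul_const _)),
      ← ofReal_abs_mul_lintegral_comp_mul_left hy
        (f := fun v => g v * (gaussianPDF 0 1 (v / ∏ j, y j) / ENNReal.ofReal |∏ j, y j|)),
      ← lintegral_const_mul']
    · refine lintegral_congr fun t => ?_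
      rw [mul_div_cancel_left₀ _ hy, mul_comm t, mul_comm (g _), ← mul_assoc,
        ENNReal.mul_div_cancel (ENNReal.ofReal_pos.2 (abs_pos.2 hy)).ne' ENNReal.ofReal_ne_top]
    · exact ENNReal.ofReal_ne_top
    · exact hg.mul (measurable_gaussianPDF_div_prod measurable_id measurable_const)
  refine (lintegral_congr_ae h2).trans ?_
  rw [lintegral_lintegral_swap]
  · refine lintegral_congr fun v => ?_
    have hv : Measurable fun y : Fin n → ℝ =>
        gaussianPDF 0 1 (v / ∏ j, y j) / ENNReal.ofReal |∏ j, y j| :=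
      measurable_gaussianPDF_div_prod measurable_const measurable_id
    rw [lintegral_const_mul _ hv, Pi.mul_apply, gaussianProdDensity_eq_lintegral_pi, mul_comm]
    rfl
  · exact ((hg.comp measurable_snd).mul (measurable_gaussianPDF_div_prod
      measurable_snd measurable_fst)).aemeasurable

theorem isProbabilityMeasure_withDensity_gaussianProdDensity {k : ℕ} (hk : 1 ≤ k) :
    IsProbabilityMeasure ((volume : Measure ℝ).withDensity (gaussianProdDensity k)) := by
  rw [← map_prod_pi_gaussianReal hk]
  exact Measure.isProbabilityMeasure_map
    (Finset.measurable_prod _ fun j _ => measurable_pi_apply j).aemeasurable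

/-- With P the product of the other factors, the left side is the expectation of |v/P| φ(v/P), and
the bound for φ applies pointwise. -/
theorem abs_mul_gaussianProdDensity_le_one (k : ℕ) (v : ℝ) :
    ENNReal.ofReal |v| * gaussianProdDensity k v ≤ 1 := by
  rw [gaussianProdDensity_eq_lintegral_pi, ← lintegral_const_mul' _ _ ENNReal.ofReal_ne_top]
  calc _ ≤ ∫⁻ _ : Fin (k - 1) → ℝ, 1 ∂Measure.pi fun _ => gaussianReal 0 1 := by
        refine lintegral_mono_ae ?_
        filter_upwards [ae_prod_ne_zero] with y hy
        rw [← mul_div_assoc, mul_comm, mul_div_assoc, ← ENNReal.ofReal_div_of_pos (abs_pos.2 hy),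
          ← abs_div, mul_comm]
        exact abs_mul_gaussianPDF_std_le_one _
    _ = 1 := by simp

/-- Integrating out one coordinate, which is kept as a dummy variable. -/
theorem lintegral_pi_update {ι : Type*} [Fintype ι] [DecidableEq ι] {X : ι → Type*}
    [∀ i, MeasurableSpace (X i)] (μ : ∀ i, Measure (X i)) [∀ i, IsProbabilityMeasure (μ i)]
    {f : (∀ i, X i) → ℝ≥0∞} (hf : Measurable f) (i : ι) :
    ∫⁻ x, f x ∂Measure.pi μ = ∫⁻ x, ∫⁻ t, f (Function.update x i t) ∂μ i ∂Measure.pi μ := by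
  have h := lmarginal_singleton (μ := μ) f i
  have hg : Measurable (∫⋯∫⁻_{i}, f ∂μ) := hf.lmarginal μ
  rw [h] at hg
  refine lintegral_eq_of_lmarginal_eq {i} hf hg ?_
  rw [h, lmarginal_singleton]
  ext x
  simp

/-- The density at `c` of `(t_{j₀} r + s) ∏_{j ≠ j₀} σ_j t_j`, `s` a further standard Gaussian. -/
theorem lintegral_pi_gaussianPDF_div_prod {k : ℕ} (j₀ : Fin k) {σ : Fin k → ℝ}
    (hσ : ∀ j, 0 < σ j) (r : ℝ) (hr : σ j₀ = √(1 + r ^ 2)) (c : ℝ) :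
    ∫⁻ t : Fin k → ℝ, gaussianPDF 0 1 (c / (∏ j ∈ Finset.univ.erase j₀, σ j * t j) - r * t j₀) /
        ENNReal.ofReal |∏ j ∈ Finset.univ.erase j₀, σ j * t j|
        ∂Measure.pi (fun _ => gaussianReal 0 1) =
      (ENNReal.ofReal (∏ j, σ j))⁻¹ * gaussianProdDensity k (c / ∏ j, σ j) := by
  obtain ⟨n, rfl⟩ : ∃ n, k = n + 1 := ⟨k - 1, by have := j₀.2; omega⟩
  have hp : ∀ f : Fin (n + 1) → ℝ, ∏ j ∈ Finset.univ.erase j₀, f j =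
      ∏ j : Fin n, f (j₀.succAbove j) := by
    intro f
    rw [← Finset.compl_singleton, ← Fin.image_succAbove_univ,
      Finset.prod_image fun _ _ _ _ h => Fin.succAbove_right_injective h]
  have hmp := measurePreserving_piFinSuccAbove (fun _ : Fin (n + 1) => gaussianReal 0 1) j₀
  simp only [hp]
  set P : (Fin n → ℝ) → ℝ := fun y => ∏ j, σ (j₀.succAbove j) * y j with hP
  have hPm : Measurable P :=
    Finset.measurable_prod _ fun j _ => (measurable_pi_apply j).const_mul _
  have hm : Measurable fun z : ℝ × (Fin n → ℝ) =>
      gaussianPDF 0 1 (c / P z.2 - r * z.1) / ENNReal.ofReal |P z.2| := by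
    refine ((measurable_gaussianPDF 0 1).comp ?_).div
      (measurable_norm.comp (hPm.comp measurable_snd)).ennreal_ofReal
    exact (measurable_const.div (hPm.comp measurable_snd)).sub (measurable_fst.const_mul r)
  refine (hmp.lintegral_comp_emb (MeasurableEquiv.measurableEmbedding _)
    (fun z : ℝ × (Fin n → ℝ) => gaussianPDF 0 1 (c / P z.2 - r * z.1) /
      ENNReal.ofReal |P z.2|)).trans ?_
  -- The variable t_{j₀} is integrated first: adding the independent s to r t_{j₀} produces a
  -- Gaussian of variance 1 + r² = σ_{j₀}².
  refine (lintegral_prod_symm' _ hm).trans ?_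
  rw [gaussianProdDensity_eq_lintegral_pi]
  have hA : 0 < ∏ j, σ j := Finset.prod_pos fun j _ => hσ j
  rw [← lintegral_const_mul' _ _ (ENNReal.inv_ne_top.2 (ENNReal.ofReal_pos.2 hA).ne')]
  refine lintegral_congr fun y => ?_
  simp only [div_eq_mul_inv (gaussianPDF _ _ _)]
  rw [lintegral_mul_const _ (by fun_prop), lintegral_gaussianPDF_sub, ← hr]
  have h1 : P y = (∏ j, σ (j₀.succAbove j)) * ∏ j, y j := Finset.prod_mul_distrib
  have hs : 0 < ∏ j, σ (j₀.succAbove j) := Finset.prod_pos fun j _ => hσ _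
  rw [Fin.prod_univ_succAbove σ j₀, h1, abs_mul, abs_of_pos hs, ENNReal.ofReal_mul hs.le,
    ENNReal.ofReal_mul (hσ j₀).le,
    ENNReal.mul_inv (Or.inr ENNReal.ofReal_ne_top) (Or.inl ENNReal.ofReal_ne_top),
    ENNReal.mul_inv (Or.inr ENNReal.ofReal_ne_top) (Or.inl ENNReal.ofReal_ne_top)]
  have h2 : c / ((∏ j, σ (j₀.succAbove j)) * ∏ j, y j) / σ j₀ =
      c / (σ j₀ * ∏ j, σ (j₀.succAbove j)) / ∏ j, y j := by
    rw [div_div, div_div]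
    congr 1
    ring
  rw [h2]
  exact mul_mul_mul_comm _ _ _ _

end ProductDensity

/-! ### Independence of blocks and passage to products of Gaussians -/

section Blocks

/-- Functions of disjoint blocks of independent variables are independent. -/
theorem map_pi_sigma {ι : Type*} [Fintype ι] {κ : ι → Type*} [∀ i, Fintype (κ i)]
    (μ : Measure ℝ) [IsProbabilityMeasure μ] {Y : ι → Type*} [∀ i, MeasurableSpace (Y i)]
    {g : ∀ i, (κ i → ℝ) → Y i} (hg : ∀ i, Measurable (g i)) :
    (Measure.pi fun _ : (i : ι) × κ i => μ).map (fun u i => g i fun p => u ⟨i, p⟩) =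
      Measure.pi fun i => (Measure.pi fun _ : κ i => μ).map (g i) := by
  have h := Measure.infinitePi_map_piCurry (κ := κ) (X := fun _ _ => ℝ) (fun _ _ => μ)
  simp only [Measure.infinitePi_eq_pi] at h
  have : ∀ i, IsProbabilityMeasure ((Measure.pi fun _ : κ i => μ).map (g i)) := fun i =>
    Measure.isProbabilityMeasure_map (hg i).aemeasurable
  rw [← Measure.pi_map_pi fun i => (hg i).aemeasurable, ← h, Measure.map_map]
  · rfl
  · exact measurable_pi_iff.2 fun i => (hg i).comp (measurable_pi_apply i)
  · exact MeasurableEquiv.measurable _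

variable {ι : Type*} [Fintype ι] {k : ι → ℕ}

/-- Linear forms in disjoint sets of Gaussians are independent, and each is a standard Gaussian
times the norm of its coefficient vector. The grouping is done twice, over i and then over j. -/
theorem map_linearForms_pi {σ : (i : ι) → Fin (k i) → Type*} [∀ i j, Fintype (σ i j)]
    (c : ∀ i j, σ i j → ℝ) :
    (Measure.pi fun _ : (i : ι) × (j : Fin (k i)) × σ i j => gaussianReal 0 1).map
        (fun u i j => ∑ s, c i j s * u ⟨i, j, s⟩) =
      (Measure.pi fun i => Measure.pi fun _ : Fin (k i) => gaussianReal 0 1).map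
        (fun t i j => √(∑ s, c i j s ^ 2) * t i j) := by
  have hg : ∀ i, Measurable fun (v : (j : Fin (k i)) × σ i j → ℝ) (j : Fin (k i)) =>
      ∑ s, c i j s * v ⟨j, s⟩ := fun i => by fun_prop
  have hg' : ∀ i j, Measurable fun v : σ i j → ℝ => ∑ s, c i j s * v s := fun i j => by fun_prop
  refine (map_pi_sigma (gaussianReal 0 1) hg).trans ?_
  have h1 : ∀ i, (Measure.pi fun _ : (j : Fin (k i)) × σ i j => gaussianReal 0 1).map
      (fun v j => ∑ s, c i j s * v ⟨j, s⟩) =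
      (Measure.pi fun _ : Fin (k i) => gaussianReal 0 1).map
        (fun t j => √(∑ s, c i j s ^ 2) * t j) := by
    intro i
    refine (map_pi_sigma (gaussianReal 0 1) (hg' i)).trans ?_
    simp only [map_sum_pi_gaussianReal]
    have : ∀ j, IsProbabilityMeasure ((gaussianReal 0 1).map
        fun t => √(∑ s, c i j s ^ 2) * t) := fun j =>
      Measure.isProbabilityMeasure_map (by fun_prop)
    rw [← Measure.pi_map_pi fun j => by fun_prop]
  simp only [h1]
  have hq : ∀ i, Measurable fun (t : Fin (k i) → ℝ) j => √(∑ s, c i j s ^ 2) * t j :=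
    fun i => by fun_prop
  have : ∀ i, IsProbabilityMeasure ((Measure.pi fun _ : Fin (k i) => gaussianReal 0 1).map
      fun t j => √(∑ s, c i j s ^ 2) * t j) := fun i =>
    Measure.isProbabilityMeasure_map (hq i).aemeasurable
  rw [← Measure.pi_map_pi fun i => (hq i).aemeasurable]

theorem map_prods_pi (hk : ∀ i, 1 ≤ k i) :
    (Measure.pi fun i => Measure.pi fun _ : Fin (k i) => gaussianReal 0 1).map
        (fun t i => ∏ j, t i j) =
      Measure.pi fun i => (volume : Measure ℝ).withDensity (gaussianProdDensity (k i)) := by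
  have hp : ∀ i, Measurable fun t : Fin (k i) → ℝ => ∏ j, t j := fun i => by fun_prop
  have : ∀ i, IsProbabilityMeasure ((Measure.pi fun _ : Fin (k i) => gaussianReal 0 1).map
      fun t => ∏ j, t j) := fun i => Measure.isProbabilityMeasure_map (hp i).aemeasurable
  simp only [← map_prod_pi_gaussianReal (hk _)]
  exact Measure.pi_map_pi fun i => (hp i).aemeasurable

/-- Passing from the Gaussian coefficients to the products of Gaussians: the factor `j₀` of the
product `i₀` enters through its conditional density. -/
theorem lintegral_blocks [DecidableEq ι] (hk : ∀ i, 1 ≤ k i) (i₀ : ι) (j₀ : Fin (k i₀))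
    {τ : (i : ι) → Fin (k i) → ℝ} {A : ι → ℝ} (hτ : ∀ j ≠ j₀, 0 < τ i₀ j)
    (hA : ∀ i ≠ i₀, ∏ j, τ i j = A i)
    (hA₀ : √(1 + τ i₀ j₀ ^ 2) * ∏ j ∈ Finset.univ.erase j₀, τ i₀ j = A i₀)
    {Ψ : (ι → ℝ) → ℝ≥0∞} (hΨ : Measurable Ψ) (hΨ₀ : ∀ w t, Ψ (Function.update w i₀ t) = Ψ w)
    {Q : (ι → ℝ) → ℝ} (hQ : Measurable Q) (hQ₀ : ∀ w t, Q (Function.update w i₀ t) = Q w) :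
    ∫⁻ t : (i : ι) → Fin (k i) → ℝ, Ψ (fun i => ∏ j, τ i j * t i j) *
        (gaussianPDF 0 1 (Q (fun i => ∏ j, τ i j * t i j) /
            (∏ j ∈ Finset.univ.erase j₀, τ i₀ j * t i₀ j) - τ i₀ j₀ * t i₀ j₀) /
          ENNReal.ofReal |∏ j ∈ Finset.univ.erase j₀, τ i₀ j * t i₀ j|)
        ∂Measure.pi (fun i => Measure.pi fun _ : Fin (k i) => gaussianReal 0 1) =
      ∫⁻ w : ι → ℝ, Ψ (fun i => A i * w i) * ((ENNReal.ofReal (A i₀))⁻¹ *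
        gaussianProdDensity (k i₀) (Q (fun i => A i * w i) / A i₀))
        ∂Measure.pi (fun i => (volume : Measure ℝ).withDensity (gaussianProdDensity (k i))) := by
  have hpm : Measurable fun (t : (i : ι) → Fin (k i) → ℝ) (i : ι) => ∏ j, t i j := by fun_prop
  have hpm' : Measurable fun (t : (i : ι) → Fin (k i) → ℝ) (i : ι) => ∏ j, τ i j * t i j := by
    fun_prop
  have hAm : Measurable fun (w : ι → ℝ) (i : ι) => A i * w i := by fun_prop
  have hindep : ∀ {α : Type} (f : (ι → ℝ) → α), (∀ w t, f (Function.update w i₀ t) = f w) →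
      ∀ w w' : ι → ℝ, (∀ i ≠ i₀, w i = w' i) → f w = f w' := by
    intro α f hf w w' h
    rw [← hf w (w' i₀)]
    congr 1
    ext i
    by_cases hi : i = i₀
    · subst hi; simp
    · simp [hi, h i hi]
  have hRm : Measurable fun w : ι → ℝ => Ψ (fun i => A i * w i) * ((ENNReal.ofReal (A i₀))⁻¹ *
      gaussianProdDensity (k i₀) (Q (fun i => A i * w i) / A i₀)) :=
    (hΨ.comp hAm).mul (((measurable_gaussianProdDensity _).comp
      ((hQ.comp hAm).div_const _)).const_mul _)
  have hBm : Measurable fun t : (i : ι) → Fin (k i) → ℝ =>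
      ∏ j ∈ Finset.univ.erase j₀, τ i₀ j * t i₀ j := by fun_prop
  rw [← map_prods_pi hk, lintegral_map hRm hpm]
  -- Only block i₀ is integrated; `Ψ` and `Q` depend on the other blocks alone and are constants
  -- here.
  rw [lintegral_pi_update _ ?_ i₀]
  · refine lintegral_congr fun t => ?_
    have h1 : ∀ s, (∀ i ≠ i₀, (∏ j, τ i j * Function.update t i₀ s i j) = A i * ∏ j, t i j) := by
      intro s i hi
      rw [Function.update_of_ne hi, Finset.prod_mul_distrib, hA i hi]
    simp only [fun s => hindep Ψ hΨ₀ _ _ (h1 s), fun s => hindep Q hQ₀ _ _ (h1 s),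
      Function.update_self]
    rw [lintegral_const_mul]
    · congr 1
      -- The omitted constant term restores variance 1 to the factor j₀. So σ is positive even if `τ
      -- i₀ j₀` vanishes.
      set σ : Fin (k i₀) → ℝ := Function.update (τ i₀) j₀ (√(1 + τ i₀ j₀ ^ 2)) with hσ
      have hσj : ∀ j ∈ Finset.univ.erase j₀, σ j = τ i₀ j := fun j hj =>
        Function.update_of_ne (Finset.ne_of_mem_erase hj) _ _
      have hσ0 : σ j₀ = √(1 + τ i₀ j₀ ^ 2) := Function.update_self _ _ _
      have hσpos : ∀ j, 0 < σ j := by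
        intro j
        by_cases hj : j = j₀
        · subst hj
          rw [hσ0]
          positivity
        · rw [hσj j (Finset.mem_erase.2 ⟨hj, Finset.mem_univ _⟩)]
          exact hτ j hj
      have hσA : ∏ j, σ j = A i₀ := by
        rw [← Finset.mul_prod_erase _ _ (Finset.mem_univ j₀), hσ0, Finset.prod_congr rfl hσj, hA₀]
      have h2 := lintegral_pi_gaussianPDF_div_prod j₀ hσpos (τ i₀ j₀) hσ0
        (Q fun i => A i * ∏ j, t i j)
      rw [hσA] at h2
      rw [← h2]
      refine lintegral_congr fun s => ?_
      rw [Finset.prod_congr rfl fun j hj => by rw [← hσj j hj]]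
    · have : Measurable fun s : Fin (k i₀) → ℝ =>
        ∏ j ∈ Finset.univ.erase j₀, τ i₀ j * s j := by fun_prop
      exact (measurable_gaussianPDF_comp ((measurable_const.div this).sub (by fun_prop))).div
        (measurable_norm.comp this).ennreal_ofReal
  · refine (hΨ.comp hpm').mul (Measurable.div ?_ (measurable_norm.comp hBm).ennreal_ofReal)
    exact measurable_gaussianPDF_comp (((hQ.comp hpm').div hBm).sub (by fun_prop))

end Blocks

noncomputable section

/-! ### Monotonicity and linearity in Z -/

section Additivity

variable {ι : Type*} [Fintype ι]

theorem measurable_density_div_norm_gradient {p : ι → ℝ → ℝ≥0∞} (hp : ∀ i, Measurable (p i))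
    (F : EuclideanSpace ℝ ι → ℝ) :
    Measurable fun u => (∏ i, p i (u i)) / ENNReal.ofReal ‖gradient F u‖ := by
  refine (measurable_prod_density hp).div (Measurable.ennreal_ofReal (Measurable.norm ?_))
  exact (LinearIsometryEquiv.continuous _).measurable.comp (measurable_fderiv ℝ F)

variable {ρ : EuclideanSpace ℝ ι → ℝ≥0∞} {F : EuclideanSpace ℝ ι → ℝ}
  {Z Z' : EuclideanSpace ℝ ι → ℝ≥0∞}

theorem condExpMulDensity_mono (h : ∀ u, Z u ≤ Z' u) (a : ℝ) :
    condExpMulDensity ρ F Z a ≤ condExpMulDensity ρ F Z' a :=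
  lintegral_mono fun u => mul_le_mul_left (h u) _

variable (hw : Measurable fun u => ρ u / ENNReal.ofReal ‖gradient F u‖)
include hw

theorem condExpMulDensity_add (hZ : Measurable Z) (a : ℝ) :
    condExpMulDensity ρ F (fun u => Z u + Z' u) a =
      condExpMulDensity ρ F Z a + condExpMulDensity ρ F Z' a := by
  simp only [condExpMulDensity, add_mul]
  exact lintegral_add_left (hZ.mul hw) _

theorem condExpMulDensity_sum {κ : Type*} (s : Finset κ) {Z : κ → EuclideanSpace ℝ ι → ℝ≥0∞}
    (hZ : ∀ i ∈ s, Measurable (Z i)) (a : ℝ) :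
    condExpMulDensity ρ F (fun u => ∑ i ∈ s, Z i u) a =
      ∑ i ∈ s, condExpMulDensity ρ F (Z i) a := by
  simp only [condExpMulDensity, Finset.sum_mul]
  exact lintegral_finsetSum _ fun i hi => (hZ i hi).mul hw

theorem condExpMulDensity_const_mul (c : ℝ≥0∞) (hZ : Measurable Z) (a : ℝ) :
    condExpMulDensity ρ F (fun u => c * Z u) a = c * condExpMulDensity ρ F Z a := by
  simp only [condExpMulDensity, mul_assoc]
  exact lintegral_const_mul _ (hZ.mul hw)

end Additivity

/-! ### Factors, cofactors and the derivative of F -/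

section SparsePolynomials

variable {m : ℕ} {k : Fin m → ℕ}

/-- The factor `f_{ij}(x) = ∑_s u_{ijs} x^s`. -/
def factor (S : (i : Fin m) → Fin (k i) → Finset ℕ) (x : ℝ) (i : Fin m) (j : Fin (k i))
    (u : EuclideanSpace ℝ (Params S)) : ℝ :=
  ∑ s : S i j, u ⟨i, j, s⟩ * x ^ (s : ℕ)

/-- The derivative `f_{ij}'(x)`. -/
def factorDeriv (S : (i : Fin m) → Fin (k i) → Finset ℕ) (x : ℝ) (i : Fin m) (j : Fin (k i))
    (u : EuclideanSpace ℝ (Params S)) : ℝ :=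
  ∑ s : S i j, u ⟨i, j, s⟩ * ((s : ℕ) * x ^ ((s : ℕ) - 1))

/-- `f_{ij}(x)` without its constant term. -/
def factorTail (S : (i : Fin m) → Fin (k i) → Finset ℕ) (x : ℝ) (i : Fin m) (j : Fin (k i))
    (u : EuclideanSpace ℝ (Params S)) : ℝ :=
  ∑ s : S i j, (if (s : ℕ) = 0 then 0 else x ^ (s : ℕ)) * u ⟨i, j, s⟩

/-- The coefficient of `f_{ij}(x)` in `F(x)`. -/
def cofactor (S : (i : Fin m) → Fin (k i) → Finset ℕ) (d : Fin m → ℕ) (x : ℝ) (i : Fin m)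
    (j : Fin (k i)) (u : EuclideanSpace ℝ (Params S)) : ℝ :=
  (∏ j' ∈ Finset.univ.erase j, factor S x i j' u) * x ^ d i

/-- The part of `F(x)` not involving the constant term of `f_{ij}`. -/
def remainder (S : (i : Fin m) → Fin (k i) → Finset ℕ) (d : Fin m → ℕ) (x : ℝ) (i : Fin m)
    (j : Fin (k i)) (u : EuclideanSpace ℝ (Params S)) : ℝ :=
  cofactor S d x i j u * factorTail S x i j u +
    ∑ i' ∈ Finset.univ.erase i, (∏ j', factor S x i' j' u) * x ^ d i'

/-- The part of `F'(x)` in which the monomials `x^{d_i}` are differentiated. -/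
def monomialDeriv (S : (i : Fin m) → Fin (k i) → Finset ℕ) (d : Fin m → ℕ) (x : ℝ)
    (u : EuclideanSpace ℝ (Params S)) : ℝ :=
  ∑ i, (∏ j, factor S x i j u) * (d i * x ^ (d i - 1))

variable {S : (i : Fin m) → Fin (k i) → Finset ℕ} {d : Fin m → ℕ} {x : ℝ}

/-- The index of the constant term of `f_{ij}`. -/
def constIndex (hS : ∀ i j, 0 ∈ S i j) (i : Fin m) (j : Fin (k i)) : Params S := ⟨i, j, 0, hS i j⟩

@[fun_prop]
theorem contDiff_factor (i : Fin m) (j : Fin (k i)) : ContDiff ℝ 1 (factor S x i j) := by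
  unfold factor
  fun_prop

@[fun_prop]
theorem contDiff_factorTail (i : Fin m) (j : Fin (k i)) : ContDiff ℝ 1 (factorTail S x i j) := by
  unfold factorTail
  fun_prop

@[fun_prop]
theorem contDiff_cofactor (i : Fin m) (j : Fin (k i)) : ContDiff ℝ 1 (cofactor S d x i j) := by
  unfold cofactor
  fun_prop

theorem contDiff_remainder (i : Fin m) (j : Fin (k i)) : ContDiff ℝ 1 (remainder S d x i j) := by
  unfold remainder
  fun_prop

theorem contDiff_monomialDeriv : ContDiff ℝ 1 (monomialDeriv S d x) := by
  unfold monomialDeriv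
  fun_prop

theorem factor_eq (hS : ∀ i j, 0 ∈ S i j) (i : Fin m) (j : Fin (k i))
    (u : EuclideanSpace ℝ (Params S)) :
    factor S x i j u = u (constIndex hS i j) + factorTail S x i j u := by
  have h : ∀ s : S i j, u ⟨i, j, s⟩ * x ^ (s : ℕ) =
      (if s = ⟨0, hS i j⟩ then u ⟨i, j, s⟩ else 0) +
        (if (s : ℕ) = 0 then 0 else x ^ (s : ℕ)) * u ⟨i, j, s⟩ := by
    rintro ⟨s, hs⟩
    by_cases h0 : s = 0
    · subst h0; simp
    · simp [h0, mul_comm]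
  rw [factor, Finset.sum_congr rfl fun s _ => h s, Finset.sum_add_distrib, factorTail]
  simp [constIndex]

theorem factor_updateCoord (hS : ∀ i j, 0 ∈ S i j) {i i' : Fin m} {j : Fin (k i)} {j' : Fin (k i')}
    (h : (⟨i', j'⟩ : Σ i, Fin (k i)) ≠ ⟨i, j⟩) (u : EuclideanSpace ℝ (Params S)) (t : ℝ) :
    factor S x i' j' (updateCoord (constIndex hS i j) u t) = factor S x i' j' u := by
  refine Finset.sum_congr rfl fun s _ => ?_
  rw [updateCoord_of_ne]
  intro h'
  apply h
  simp only [constIndex, Sigma.mk.injEq] at h'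
  obtain ⟨rfl, h'⟩ := h'
  have h2 := eq_of_heq h'
  simp only [Sigma.mk.injEq] at h2
  rw [h2.1]

theorem factorTail_updateCoord (hS : ∀ i j, 0 ∈ S i j) (i : Fin m) (j : Fin (k i))
    (u : EuclideanSpace ℝ (Params S)) (t : ℝ) :
    factorTail S x i j (updateCoord (constIndex hS i j) u t) = factorTail S x i j u := by
  refine Finset.sum_congr rfl fun s _ => ?_
  by_cases h0 : (s : ℕ) = 0
  · simp [h0]
  · rw [updateCoord_of_ne]
    intro h'
    simp only [constIndex, Sigma.mk.injEq, heq_eq_eq, true_and] at h'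
    exact h0 (by rw [h'])

theorem cofactor_updateCoord (hS : ∀ i j, 0 ∈ S i j) (i : Fin m) (j : Fin (k i))
    (u : EuclideanSpace ℝ (Params S)) (t : ℝ) :
    cofactor S d x i j (updateCoord (constIndex hS i j) u t) = cofactor S d x i j u := by
  unfold cofactor
  congr 1
  refine Finset.prod_congr rfl fun j' hj' => factor_updateCoord hS ?_ u t
  simpa using Finset.ne_of_mem_erase hj'

theorem prod_factor_updateCoord (hS : ∀ i j, 0 ∈ S i j) {i i' : Fin m} (h : i' ≠ i) (j : Fin (k i))
    (u : EuclideanSpace ℝ (Params S)) (t : ℝ) :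
    ∏ j', factor S x i' j' (updateCoord (constIndex hS i j) u t) = ∏ j', factor S x i' j' u := by
  refine Finset.prod_congr rfl fun j' _ => factor_updateCoord hS ?_ u t
  intro h'
  exact h (congrArg Sigma.fst h')

theorem sumProd_eq_cofactor_mul_factor (i : Fin m) (j : Fin (k i))
    (u : EuclideanSpace ℝ (Params S)) :
    sumProd S d x u = cofactor S d x i j u * factor S x i j u +
      ∑ i' ∈ Finset.univ.erase i, (∏ j', factor S x i' j' u) * x ^ d i' := by
  rw [sumProd, ← Finset.add_sum_erase _ _ (Finset.mem_univ i),
    ← Finset.mul_prod_erase _ _ (Finset.mem_univ j)]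
  simp only [cofactor, factor]
  ring

/-- The constant term of f_ij enters f_ij with coefficient 1 and occurs in no other factor. -/
theorem isAffineInCoord_sumProd (hS : ∀ i j, 0 ∈ S i j) (i : Fin m) (j : Fin (k i)) :
    IsAffineInCoord (constIndex hS i j) (sumProd S d x) (remainder S d x i j)
      (cofactor S d x i j) where
  contDiff_left := contDiff_remainder i j
  contDiff_right := contDiff_cofactor i j
  eq u := by
    rw [sumProd_eq_cofactor_mul_factor i j, factor_eq hS, remainder]
    ring
  left_update u t := by
    unfold remainder
    rw [cofactor_updateCoord, factorTail_updateCoord]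
    congr 1
    refine Finset.sum_congr rfl fun i' hi' => ?_
    rw [prod_factor_updateCoord hS (Finset.ne_of_mem_erase hi')]
  right_update u t := cofactor_updateCoord hS i j u t

theorem hasDerivAt_factor (i : Fin m) (j : Fin (k i)) (u : EuclideanSpace ℝ (Params S)) (x : ℝ) :
    HasDerivAt (fun y => factor S y i j u) (factorDeriv S x i j u) x := by
  unfold factor factorDeriv
  exact HasDerivAt.fun_sum fun s _ => (hasDerivAt_pow (s : ℕ) x).const_mul _

theorem deriv_sumProd (u : EuclideanSpace ℝ (Params S)) (x : ℝ) :
    deriv (fun y => sumProd S d y u) x =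
      ∑ i, ∑ j, factorDeriv S x i j u * cofactor S d x i j u + monomialDeriv S d x u := by
  refine HasDerivAt.deriv ?_
  have h : ∀ i, HasDerivAt (fun y => (∏ j, factor S y i j u) * y ^ d i)
      (∑ j, factorDeriv S x i j u * cofactor S d x i j u +
        (∏ j, factor S x i j u) * (d i * x ^ (d i - 1))) x := by
    intro i
    have h1 := (HasDerivAt.fun_finsetProd (u := Finset.univ)
      fun j _ => hasDerivAt_factor i j u x).mul (hasDerivAt_pow (d i) x)
    refine h1.congr_deriv ?_
    simp only [smul_eq_mul, Finset.sum_mul, cofactor]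
    congr 1
    exact Finset.sum_congr rfl fun j _ => by ring
  refine (HasDerivAt.fun_sum fun i _ => h i).congr_deriv ?_
  rw [Finset.sum_add_distrib, monomialDeriv]

/-- Splitting down to single coefficients allows each term to be estimated in the graph coordinates
of its own factor, where its cofactor is the slope B. -/
theorem abs_deriv_sumProd_le (u : EuclideanSpace ℝ (Params S)) (x : ℝ) :
    ENNReal.ofReal |deriv (fun y => sumProd S d y u) x| ≤
      ∑ i, ∑ j, ∑ s : S i j, ENNReal.ofReal ((s : ℕ) * |x| ^ ((s : ℕ) - 1)) *
        (ENNReal.ofReal |u ⟨i, j, s⟩| * ENNReal.ofReal |cofactor S d x i j u|) +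
      ENNReal.ofReal |monomialDeriv S d x u| := by
  have h : |deriv (fun y => sumProd S d y u) x| ≤
      ∑ i, ∑ j, ∑ s : S i j, ((s : ℕ) * |x| ^ ((s : ℕ) - 1)) *
        (|u ⟨i, j, s⟩| * |cofactor S d x i j u|) + |monomialDeriv S d x u| := by
    rw [deriv_sumProd]
    refine (abs_add_le _ _).trans ?_
    gcongr
    refine (Finset.abs_sum_le_sum_abs _ _).trans (Finset.sum_le_sum fun i _ => ?_)
    refine (Finset.abs_sum_le_sum_abs _ _).trans (Finset.sum_le_sum fun j _ => ?_)
    rw [abs_mul]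
    refine (mul_le_mul_of_nonneg_right (Finset.abs_sum_le_sum_abs _ _) (abs_nonneg _)).trans ?_
    rw [Finset.sum_mul]
    refine Finset.sum_le_sum fun s _ => le_of_eq ?_
    rw [abs_mul, abs_mul, abs_pow, Nat.abs_cast]
    ring
  refine (ENNReal.ofReal_le_ofReal h).trans (ENNReal.ofReal_add_le.trans ?_)
  gcongr
  rw [ENNReal.ofReal_sum_of_nonneg fun i _ => by positivity]
  refine Finset.sum_le_sum fun i _ => ?_
  rw [ENNReal.ofReal_sum_of_nonneg fun j _ => by positivity]
  refine Finset.sum_le_sum fun j _ => ?_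
  rw [ENNReal.ofReal_sum_of_nonneg fun s _ => by positivity]
  refine Finset.sum_le_sum fun s _ => ?_
  rw [ENNReal.ofReal_mul (by positivity), ENNReal.ofReal_mul (abs_nonneg _)]

theorem measurable_abs_coord_mul_abs_cofactor (i : Fin m) (j : Fin (k i)) (l : Params S) :
    Measurable fun u : EuclideanSpace ℝ (Params S) =>
      ENNReal.ofReal |u l| * ENNReal.ofReal |cofactor S d x i j u| := by
  have h : Measurable fun u : EuclideanSpace ℝ (Params S) => u l := by fun_prop
  exact (measurable_norm.comp h).ennreal_ofReal.mul
    (measurable_norm.comp (contDiff_cofactor i j).continuous.measurable).ennreal_ofReal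

theorem lintegral_pi_gaussianReal_abs_le_one {ι : Type*} [Fintype ι] (l : ι) :
    ∫⁻ u : ι → ℝ, ENNReal.ofReal |u l| ∂Measure.pi (fun _ => gaussianReal 0 1) ≤ 1 := by
  refine le_trans (le_of_eq ?_) lintegral_abs_gaussianReal_le_one
  exact (measurePreserving_eval (fun _ : ι => gaussianReal 0 1) l).lintegral_comp
    (f := fun t => ENNReal.ofReal |t|) (by fun_prop)

/-- The contribution of one coefficient of `f_{ij}'`. -/
theorem condExpMulDensity_coord_mul_cofactor_le (hS : ∀ i j, 0 ∈ S i j) (i : Fin m) (j : Fin (k i))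
    (s : S i j) (hs : (s : ℕ) ≠ 0) (a : ℝ) :
    condExpMulDensity (gaussianDensity S) (sumProd S d x) (fun u =>
      ENNReal.ofReal |u ⟨i, j, s⟩| * ENNReal.ofReal |cofactor S d x i j u|) a ≤
      ENNReal.ofReal (√(2 * Real.pi))⁻¹ := by
  have hF := isAffineInCoord_sumProd (d := d) (x := x) hS i j
  -- As s ≠ 0, the coefficient u_ijs is not the coordinate being solved for and keeps its Gaussian
  -- law.
  have hne : (⟨i, j, s⟩ : Params S) ≠ constIndex hS i j := by
    intro h
    simp only [constIndex, Sigma.mk.injEq, heq_eq_eq, true_and] at h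
    exact hs (by rw [h])
  have h := hF.condExpMulDensity_le a (p := fun _ => gaussianPDF 0 1)
    (fun _ => measurable_gaussianPDF 0 1)
    (measurable_abs_coord_mul_abs_cofactor (d := d) (x := x) i j ⟨i, j, s⟩)
  refine le_trans (le_of_eq ?_) (h.trans ?_)
  -- Nothing is lost by restricting to B ≠ 0, because the integrand contains the factor |B|.
  · rw [condExpMulDensity, ← lintegral_indicator
      (isOpen_ne_fun hF.contDiff_right.continuous continuous_const).measurableSet]
    refine lintegral_congr fun u => ?_
    by_cases hu : cofactor S d x i j u ≠ 0
    · rw [Set.indicator_of_mem hu, gaussianDensity]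
    · rw [Set.indicator_of_notMem hu]
      simp [not_not.1 hu]
  · simp only [withDensity_gaussianPDF]
    calc _ ≤ ∫⁻ u : Params S → ℝ, ENNReal.ofReal |u ⟨i, j, s⟩| * ENNReal.ofReal (√(2 * Real.pi))⁻¹
          ∂Measure.pi fun _ => gaussianReal 0 1 := by
          refine (setLIntegral_mono' ?_ fun u hu => ?_).trans (setLIntegral_le_lintegral _ _)
          · exact (PiLp.volume_preserving_toLp _).measurable
              (isOpen_ne_fun hF.contDiff_right.continuous continuous_const).measurableSet
          · rw [hF.right_update, updateCoord_of_ne hne, mul_assoc, mul_div_assoc]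
            refine mul_le_mul_right ?_ _
            rw [mul_comm, ENNReal.mul_div_cancel_right
              (ENNReal.ofReal_pos.2 (abs_pos.2 hu)).ne' ENNReal.ofReal_ne_top]
            exact gaussianPDF_std_le _
      _ ≤ 1 * ENNReal.ofReal (√(2 * Real.pi))⁻¹ := by
          rw [lintegral_mul_const _ (by fun_prop)]
          gcongr
          exact lintegral_pi_gaussianReal_abs_le_one _
      _ = _ := one_mul _

end SparsePolynomials

/-! ### The part of F' that differentiates the monomials -/

section MonomialDerivative

variable {m : ℕ} {k : Fin m → ℕ} {S : (i : Fin m) → Fin (k i) → Finset ℕ} {d : Fin m → ℕ} {x : ℝ}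

theorem one_le_alpha {S : Finset ℕ} (hS : 0 ∈ S) (x : ℝ) : 1 ≤ alpha S x := by
  have h := Finset.single_le_sum (f := fun s => x ^ (2 * s)) (fun s _ => by
    rw [pow_mul]
    positivity) hS
  simpa [alpha] using h

theorem alpha_pos {S : Finset ℕ} (hS : 0 ∈ S) (x : ℝ) : 0 < alpha S x :=
  one_pos.trans_le (one_le_alpha hS x)

theorem alphaProd_pos (hS : ∀ i j, 0 ∈ S i j) (i : Fin m) (x : ℝ) : 0 < alphaProd S i x :=
  Finset.prod_pos fun j _ => alpha_pos (hS i j) x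

/-- The coefficients of the linear forms `f_{ij}(x)`, where the constant term of `f_{i₀j₀}` is
omitted. -/
def tailCoeff (S : (i : Fin m) → Fin (k i) → Finset ℕ) (x : ℝ) (p : Σ i, Fin (k i)) (i : Fin m)
    (j : Fin (k i)) (s : S i j) : ℝ :=
  if (⟨i, j⟩ : Σ i, Fin (k i)) = p ∧ (s : ℕ) = 0 then 0 else x ^ (s : ℕ)

theorem sum_tailCoeff_mul_of_ne {p : Σ i, Fin (k i)} {i : Fin m} {j : Fin (k i)}
    (h : (⟨i, j⟩ : Σ i, Fin (k i)) ≠ p) (u : EuclideanSpace ℝ (Params S)) :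
    ∑ s, tailCoeff S x p i j s * u ⟨i, j, s⟩ = factor S x i j u := by
  refine Finset.sum_congr rfl fun s _ => ?_
  rw [tailCoeff, if_neg (fun h' => h h'.1), mul_comm]

theorem sum_tailCoeff_mul_self (i : Fin m) (j : Fin (k i)) (u : EuclideanSpace ℝ (Params S)) :
    ∑ s, tailCoeff S x ⟨i, j⟩ i j s * u ⟨i, j, s⟩ = factorTail S x i j u := by
  refine Finset.sum_congr rfl fun s _ => ?_
  simp [tailCoeff]

theorem sum_sq_tailCoeff_of_ne {p : Σ i, Fin (k i)} {i : Fin m} {j : Fin (k i)}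
    (h : (⟨i, j⟩ : Σ i, Fin (k i)) ≠ p) :
    ∑ s, tailCoeff S x p i j s ^ 2 = alpha (S i j) x := by
  rw [alpha, ← Finset.sum_coe_sort (S i j)]
  refine Finset.sum_congr rfl fun s _ => ?_
  rw [tailCoeff, if_neg (fun h' => h h'.1), ← pow_mul, mul_comm]

theorem one_add_sum_sq_tailCoeff_self (hS : ∀ i j, 0 ∈ S i j) (i : Fin m) (j : Fin (k i)) :
    1 + ∑ s, tailCoeff S x ⟨i, j⟩ i j s ^ 2 = alpha (S i j) x := by
  have h : ∀ s : S i j, x ^ (2 * (s : ℕ)) = (if s = ⟨0, hS i j⟩ then 1 else 0) +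
      tailCoeff S x ⟨i, j⟩ i j s ^ 2 := by
    rintro ⟨s, hs⟩
    by_cases h0 : s = 0
    · subst h0; simp [tailCoeff]
    · simp [tailCoeff, h0, ← pow_mul, mul_comm]
  rw [alpha, ← Finset.sum_coe_sort (S i j), Finset.sum_congr rfl fun s _ => h s, Finset.sum_add_distrib]
  simp

/-- The value f_ij(x) is a centered Gaussian of variance α_ij(x) ≥ 1, hence has no atom at 0. -/
theorem ae_factor_ne_zero (hS : ∀ i j, 0 ∈ S i j) {i : Fin m} (j : Fin (k i)) :
    ∀ᵐ u : Params S → ℝ ∂Measure.pi fun _ => gaussianReal 0 1,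
      factor S x i j (WithLp.toLp 2 u) ≠ 0 := by
  have hlaw := map_linearForms_pi (ι := Fin m) (k := k) (σ := fun i j => S i j)
    (fun i j s => x ^ (s : ℕ))
  have hms : MeasurableSet {M : (i : Fin m) → Fin (k i) → ℝ | M i j ≠ 0} :=
    measurableSet_eq_fun (by fun_prop) measurable_const |>.compl
  have h1 := congrArg (fun μ => ∀ᵐ M ∂μ, M i j ≠ 0) hlaw
  have hm₁ : Measurable fun (u : Params S → ℝ) (i : Fin m) (j : Fin (k i)) =>
      ∑ s : S i j, x ^ (s : ℕ) * u ⟨i, j, s⟩ := by fun_prop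
  have hm₂ : Measurable fun (t : (i : Fin m) → Fin (k i) → ℝ) (i : Fin m) (j : Fin (k i)) =>
      √(∑ s : S i j, (x ^ (s : ℕ)) ^ 2) * t i j := by fun_prop
  rw [ae_map_iff hm₁.aemeasurable hms, ae_map_iff hm₂.aemeasurable hms] at h1
  have h2 : ∀ u : Params S → ℝ, factor S x i j (WithLp.toLp 2 u) =
      ∑ s : S i j, x ^ (s : ℕ) * u ⟨i, j, s⟩ := fun u =>
    Finset.sum_congr rfl fun s _ => mul_comm _ _
  simp only [h2]
  refine h1.mpr ?_
  have : NullSingletonClass (gaussianReal 0 1) := nullSingletonClass_gaussianReal one_ne_zero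
  have h3 : ∀ᵐ t : Fin (k i) → ℝ ∂Measure.pi fun _ => gaussianReal 0 1, t j ≠ 0 :=
    (measurePreserving_eval (fun _ => gaussianReal 0 1) j).quasiMeasurePreserving.ae
      (p := fun t => t ≠ 0) (Measure.ae_ne (gaussianReal 0 1) 0)
  have h4 : ∀ᵐ t : (i : Fin m) → Fin (k i) → ℝ
      ∂Measure.pi fun i => Measure.pi fun _ => gaussianReal 0 1, t i j ≠ 0 :=
    (measurePreserving_eval (fun i : Fin m => Measure.pi fun _ : Fin (k i) => gaussianReal 0 1)
      i).quasiMeasurePreserving.ae h3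
  filter_upwards [h4] with t ht
  refine mul_ne_zero (Real.sqrt_pos.2 ?_).ne' ht
  have := alpha_pos (hS i j) x
  rw [alpha, ← Finset.sum_coe_sort (S i j)] at this
  simpa [← pow_mul, mul_comm] using this

theorem ae_cofactor_ne_zero (hS : ∀ i j, 0 ∈ S i j) {i : Fin m} (hd : d i = 0) (j : Fin (k i)) :
    ∀ᵐ u : Params S → ℝ ∂Measure.pi fun _ => gaussianReal 0 1,
      cofactor S d x i j (WithLp.toLp 2 u) ≠ 0 := by
  filter_upwards [ae_all_iff.2 fun j => ae_factor_ne_zero (x := x) hS j] with u hu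
  rw [cofactor, hd, pow_zero, mul_one]
  exact Finset.prod_ne_zero_iff.2 fun j' _ => hu j'

theorem cofactor_updateCoord_of_ne (hS : ∀ i j, 0 ∈ S i j) {i i' : Fin m} (h : i' ≠ i)
    {j : Fin (k i)} {j' : Fin (k i')} (u : EuclideanSpace ℝ (Params S)) (t : ℝ) :
    cofactor S d x i' j' (updateCoord (constIndex hS i j) u t) = cofactor S d x i' j' u := by
  unfold cofactor
  congr 1
  exact Finset.prod_congr rfl fun j' _ =>
    factor_updateCoord hS (fun h' => h (congrArg Sigma.fst h')) u t

/-- The locus where the leading cofactor vanishes does not contribute. -/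
theorem condExpMulDensity_sumProd_le_setLIntegral (hk : ∀ i, 1 ≤ k i) (hS : ∀ i j, 0 ∈ S i j)
    {i₀ : Fin m} (hd : d i₀ = 0) (j₀ : Fin (k i₀)) {a : ℝ} (ha : a ≠ 0)
    {Z : EuclideanSpace ℝ (Params S) → ℝ≥0∞} (hZ : Measurable Z) :
    condExpMulDensity (gaussianDensity S) (sumProd S d x) Z a ≤
      ∫⁻ u in {u | cofactor S d x i₀ j₀ u ≠ 0}, Z u *
        (gaussianDensity S u / ENNReal.ofReal ‖gradient (sumProd S d x) u‖)
        ∂levelVolume (sumProd S d x) a := by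
  have hF := fun i j => isAffineInCoord_sumProd (d := d) (x := x) hS i j
  set w : EuclideanSpace ℝ (Params S) → ℝ≥0∞ := fun u =>
    gaussianDensity S u / ENNReal.ofReal ‖gradient (sumProd S d x) u‖ with hw
  have hwm : Measurable w := measurable_density_div_norm_gradient
    (fun _ => measurable_gaussianPDF 0 1) _
  have hne : ∀ i j, MeasurableSet {u | cofactor S d x i j u ≠ 0} := fun i j =>
    (isOpen_ne_fun (contDiff_cofactor i j).continuous continuous_const).measurableSet
  set Z₀ : EuclideanSpace ℝ (Params S) → ℝ≥0∞ :=
    {u | cofactor S d x i₀ j₀ u ≠ 0}ᶜ.indicator Z with hZ₀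
  have hZ₀m : Measurable Z₀ := hZ.indicator (hne i₀ j₀).compl
  let jj : ∀ i, Fin (k i) := fun i => ⟨0, hk i⟩
  -- In graph coordinates for a constant term of the i-th summand, the leading cofactor is
  -- independent of the coordinate solved for and almost surely nonzero, so `Z₀` vanishes almost
  -- everywhere.
  have hnull : ∀ i ≠ i₀, ∫⁻ u in {u | cofactor S d x i (jj i) u ≠ 0}, Z₀ u * w u
      ∂levelVolume (sumProd S d x) a = 0 := by
    intro i hi
    refine le_antisymm (((hF i (jj i)).condExpMulDensity_le a (p := fun _ => gaussianPDF 0 1)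
      (fun _ => measurable_gaussianPDF 0 1) hZ₀m).trans ?_) zero_le
    refine (setLIntegral_le_lintegral _ _).trans (le_of_eq ?_)
    rw [← lintegral_zero (μ := Measure.pi fun _ : Params S =>
      (volume : Measure ℝ).withDensity (gaussianPDF 0 1))]
    refine lintegral_congr_ae ?_
    simp only [withDensity_gaussianPDF]
    filter_upwards [ae_cofactor_ne_zero (x := x) hS hd j₀] with u hu
    have : ∀ t, Z₀ (updateCoord (constIndex hS i (jj i)) (WithLp.toLp 2 u) t) = 0 := fun t => by
      rw [hZ₀, Set.indicator_of_notMem]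
      simpa [cofactor_updateCoord_of_ne hS hi.symm] using hu
    simp [this]
  have hcompl : ∫⁻ u in {u | cofactor S d x i₀ j₀ u ≠ 0}ᶜ, Z u * w u
      ∂levelVolume (sumProd S d x) a = 0 := by
    have hae : ∀ᵐ u ∂levelVolume (sumProd S d x) a, sumProd S d x u = a := by
      have : MeasurableSet (sumProd S d x ⁻¹' {a}) :=
        ((hF i₀ j₀).contDiff.continuous.measurable) (measurableSet_singleton a)
      filter_upwards [ae_restrict_mem this] with u hu using hu
    refine le_antisymm ?_ zero_le
    calc ∫⁻ u in {u | cofactor S d x i₀ j₀ u ≠ 0}ᶜ, Z u * w u ∂levelVolume (sumProd S d x) a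
        ≤ ∫⁻ u, ∑ i ∈ Finset.univ.erase i₀, {u | cofactor S d x i (jj i) u ≠ 0}.indicator
            (fun u => Z₀ u * w u) u ∂levelVolume (sumProd S d x) a := by
          rw [← lintegral_indicator (hne i₀ j₀).compl]
          refine lintegral_mono_ae ?_
          filter_upwards [hae] with u hu
          by_cases h0 : cofactor S d x i₀ j₀ u ≠ 0
          · rw [Set.indicator_of_notMem (by simpa using h0)]
            exact zero_le
          · have h0' : u ∈ {u | cofactor S d x i₀ j₀ u ≠ 0}ᶜ := h0
            -- When the leading cofactor is 0, so is the i₀-th summand. As F = a ≠ 0, another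
            -- summand is nonzero, and with it its cofactors.
            have hex : ∃ i ∈ Finset.univ.erase i₀, (∏ j', factor S x i j' u) * x ^ d i ≠ 0 := by
              by_contra! hcon
              rw [sumProd_eq_cofactor_mul_factor i₀ j₀, not_not.1 h0, zero_mul, zero_add,
                Finset.sum_eq_zero hcon] at hu
              exact ha hu.symm
            obtain ⟨i, hi, hne'⟩ := hex
            have hi' : cofactor S d x i (jj i) u ≠ 0 := by
              rw [← Finset.mul_prod_erase _ _ (Finset.mem_univ (jj i)), mul_assoc] at hne'
              exact right_ne_zero_of_mul hne'
            refine le_trans (le_of_eq ?_) (Finset.single_le_sum (fun _ _ => zero_le) hi)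
            rw [Set.indicator_of_mem h0', Set.indicator_of_mem hi', hZ₀, Set.indicator_of_mem h0']
      _ = 0 := by
          rw [lintegral_finsetSum]
          swap
          · exact fun i _ => (hZ₀m.mul hwm).indicator (hne i (jj i))
          refine Finset.sum_eq_zero fun i hi => ?_
          rw [lintegral_indicator (hne i (jj i))]
          exact hnull i (Finset.ne_of_mem_erase hi)
  rw [condExpMulDensity, ← lintegral_add_compl _ (hne i₀ j₀), hcompl, add_zero]

theorem sqrt_alphaProd (hS : ∀ i j, 0 ∈ S i j) {A : Fin m → ℝ}
    (hA : ∀ i, A i = √(alphaProd S i x)) (i : Fin m) : A i = ∏ j, √(alpha (S i j) x) := by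
  rw [hA, Real.sqrt_eq_iff_mul_self_eq (alphaProd_pos hS i x).le
    (Finset.prod_nonneg fun j _ => Real.sqrt_nonneg _), ← Finset.prod_mul_distrib, alphaProd]
  exact Finset.prod_congr rfl fun j _ => (Real.mul_self_sqrt (alpha_pos (hS i j) x).le).symm

/-- The contribution of the derivatives of the monomials, in terms of products of Gaussians. -/
theorem condExpMulDensity_monomialDeriv_le (hk : ∀ i, 1 ≤ k i) (hS : ∀ i j, 0 ∈ S i j)
    {i₀ : Fin m} (hd : d i₀ = 0) {a : ℝ} (ha : a ≠ 0) {A : Fin m → ℝ}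
    (hA : ∀ i, A i = √(alphaProd S i x)) :
    condExpMulDensity (gaussianDensity S) (sumProd S d x)
      (fun u => ENNReal.ofReal |monomialDeriv S d x u|) a ≤
    ∫⁻ w : Fin m → ℝ, ENNReal.ofReal |∑ i, A i * w i * (d i * x ^ (d i - 1))| *
        ((ENNReal.ofReal (A i₀))⁻¹ * gaussianProdDensity (k i₀)
          ((a - ∑ i ∈ Finset.univ.erase i₀, A i * w i * x ^ d i) / A i₀))
        ∂Measure.pi (fun i => (volume : Measure ℝ).withDensity (gaussianProdDensity (k i))) := by
  let j₀ : Fin (k i₀) := ⟨0, hk i₀⟩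
  have hF := isAffineInCoord_sumProd (d := d) (x := x) hS i₀ j₀
  have hZm : Measurable fun u => ENNReal.ofReal |monomialDeriv S d x u| :=
    (measurable_norm.comp
      (contDiff_monomialDeriv (S := S) (d := d) (x := x)).continuous.measurable).ennreal_ofReal
  refine (condExpMulDensity_sumProd_le_setLIntegral hk hS hd j₀ ha hZm).trans ?_
  refine (hF.condExpMulDensity_le a (p := fun _ => gaussianPDF 0 1)
    (fun _ => measurable_gaussianPDF 0 1) hZm).trans ?_
  simp only [withDensity_gaussianPDF]
  set Ψ : (Fin m → ℝ) → ℝ≥0∞ := fun p => ENNReal.ofReal |∑ i, p i * (d i * x ^ (d i - 1))| with hΨ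
  set Q : (Fin m → ℝ) → ℝ := fun p => a - ∑ i ∈ Finset.univ.erase i₀, p i * x ^ d i with hQ
  have hΨm : Measurable Ψ := by
    have : Measurable fun p : Fin m → ℝ => ∑ i, p i * (d i * x ^ (d i - 1)) := by fun_prop
    exact (measurable_norm.comp this).ennreal_ofReal
  have hQm : Measurable Q := by fun_prop
  -- The i₀-th term carries the factor d_{i₀} = 0.
  have hΨ' : ∀ p q : Fin m → ℝ, (∀ i ≠ i₀, p i = q i) → Ψ p = Ψ q := by
    intro p q h
    simp only [hΨ]
    congr 2
    refine Finset.sum_congr rfl fun i _ => ?_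
    by_cases hi : i = i₀
    · subst hi; simp [hd]
    · rw [h i hi]
  have hQ' : ∀ p q : Fin m → ℝ, (∀ i ≠ i₀, p i = q i) → Q p = Q q := by
    intro p q h
    simp only [hQ]
    congr 1
    exact Finset.sum_congr rfl fun i hi => by rw [h i (Finset.ne_of_mem_erase hi)]
  set c := fun i j (s : S i j) => tailCoeff S x ⟨i₀, j₀⟩ i j s with hc
  -- Standard deviations of the f_ij(x), with the constant term of f_{i₀j₀} left out since it is the
  -- coordinate solved for.
  set τ : (i : Fin m) → Fin (k i) → ℝ := fun i j => √(∑ s, c i j s ^ 2) with hτ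
  have hτne : ∀ i j, (⟨i, j⟩ : Σ i, Fin (k i)) ≠ ⟨i₀, j₀⟩ → τ i j = √(alpha (S i j) x) :=
    fun i j h => by rw [hτ]; simp only [hc]; rw [sum_sq_tailCoeff_of_ne h]
  have hτ0 : 1 + τ i₀ j₀ ^ 2 = alpha (S i₀ j₀) x := by
    rw [← one_add_sum_sq_tailCoeff_self hS i₀ j₀, hτ]
    simp only [hc]
    rw [Real.sq_sqrt (Finset.sum_nonneg fun s _ => sq_nonneg _)]
  have hne : ∀ i ≠ i₀, ∀ j, (⟨i, j⟩ : Σ i, Fin (k i)) ≠ ⟨i₀, j₀⟩ := fun i hi j h =>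
    hi (congrArg Sigma.fst h)
  have hne' : ∀ j ≠ j₀, (⟨i₀, j⟩ : Σ i, Fin (k i)) ≠ ⟨i₀, j₀⟩ := fun j hj h =>
    hj (by simpa using h)
  have hblocks := lintegral_blocks hk i₀ j₀ (τ := τ) (A := A)
    (fun j hj => by
      rw [hτne i₀ j (hne' j hj)]
      exact Real.sqrt_pos.2 (alpha_pos (hS _ _) x))
    (fun i hi => by
      rw [sqrt_alphaProd hS hA i]
      exact Finset.prod_congr rfl fun j _ => hτne i j (hne i hi j))
    (by
      rw [sqrt_alphaProd hS hA i₀, hτ0, ← Finset.mul_prod_erase _ _ (Finset.mem_univ j₀)]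
      congr 1
      exact Finset.prod_congr rfl fun j hj => hτne i₀ j (hne' j (Finset.ne_of_mem_erase hj)))
    hΨm (fun w t => hΨ' _ _ fun i hi => Function.update_of_ne hi _ _)
    hQm (fun w t => hQ' _ _ fun i hi => Function.update_of_ne hi _ _)
  refine le_trans ?_ hblocks.le
  set H : ((i : Fin m) → Fin (k i) → ℝ) → ℝ≥0∞ := fun M => Ψ (fun i => ∏ j, M i j) *
    (gaussianPDF 0 1 (Q (fun i => ∏ j, M i j) / (∏ j ∈ Finset.univ.erase j₀, M i₀ j) - M i₀ j₀) /
      ENNReal.ofReal |∏ j ∈ Finset.univ.erase j₀, M i₀ j|) with hH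
  have hpm : Measurable fun (M : (i : Fin m) → Fin (k i) → ℝ) i => ∏ j, M i j := by fun_prop
  have hem : Measurable fun M : (i : Fin m) → Fin (k i) → ℝ =>
      ∏ j ∈ Finset.univ.erase j₀, M i₀ j := by fun_prop
  have hHm : Measurable H := (hΨm.comp hpm).mul ((measurable_gaussianPDF_comp
    (((hQm.comp hpm).div hem).sub (by fun_prop))).div (measurable_norm.comp hem).ennreal_ofReal)
  have hlaw := map_linearForms_pi (ι := Fin m) (k := k) (σ := fun i j => S i j) c
  have hLm : Measurable fun (u : Params S → ℝ) i j => ∑ s, c i j s * u ⟨i, j, s⟩ := by fun_prop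
  have hTm : Measurable fun (t : (i : Fin m) → Fin (k i) → ℝ) i j => τ i j * t i j := by fun_prop
  have hint : ∫⁻ u : Params S → ℝ, H (fun i j => ∑ s, c i j s * u ⟨i, j, s⟩)
      ∂Measure.pi (fun _ => gaussianReal 0 1) =
      ∫⁻ t : (i : Fin m) → Fin (k i) → ℝ, H (fun i j => τ i j * t i j)
        ∂Measure.pi fun i => Measure.pi fun _ => gaussianReal 0 1 := by
    rw [← lintegral_map hHm hLm, ← lintegral_map hHm hTm]
    exact congrArg (fun μ => ∫⁻ M, H M ∂μ) hlaw
  refine le_trans ?_ hint.le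
  refine (setLIntegral_mono' ?_ fun u hu => ?_).trans (setLIntegral_le_lintegral _ _)
  · exact (PiLp.volume_preserving_toLp _).measurable
      (isOpen_ne_fun hF.contDiff_right.continuous continuous_const).measurableSet
  set U : EuclideanSpace ℝ (Params S) := WithLp.toLp 2 u with hU
  have hu' : cofactor S d x i₀ j₀ U ≠ 0 := hu
  have hMne : ∀ i ≠ i₀, ∀ j, ∑ s, c i j s * u ⟨i, j, s⟩ = factor S x i j U := fun i hi j =>
    sum_tailCoeff_mul_of_ne (hne i hi j) U
  have hMe : ∏ j ∈ Finset.univ.erase j₀, ∑ s, c i₀ j s * u ⟨i₀, j, s⟩ =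
      cofactor S d x i₀ j₀ U := by
    rw [cofactor, hd, pow_zero, mul_one]
    exact Finset.prod_congr rfl fun j hj =>
      sum_tailCoeff_mul_of_ne (hne' j (Finset.ne_of_mem_erase hj)) U
  have hM0 : ∑ s, c i₀ j₀ s * u ⟨i₀, j₀, s⟩ = factorTail S x i₀ j₀ U :=
    sum_tailCoeff_mul_self i₀ j₀ U
  have hΨU : ∀ t, Ψ (fun i => ∏ j, ∑ s, c i j s * u ⟨i, j, s⟩) =
      ENNReal.ofReal |monomialDeriv S d x (updateCoord (constIndex hS i₀ j₀) U t)| := by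
    intro t
    refine hΨ' _ _ fun i hi => ?_
    rw [prod_factor_updateCoord hS hi]
    exact Finset.prod_congr rfl fun j _ => hMne i hi j
  -- The height (a - C)/B, rewritten in terms of the linear forms alone, so that their joint law can
  -- be inserted.
  have hQU : Q (fun i => ∏ j, ∑ s, c i j s * u ⟨i, j, s⟩) / cofactor S d x i₀ j₀ U -
      factorTail S x i₀ j₀ U = (a - remainder S d x i₀ j₀ U) / cofactor S d x i₀ j₀ U := by
    have : Q (fun i => ∏ j, ∑ s, c i j s * u ⟨i, j, s⟩) =
        a - ∑ i' ∈ Finset.univ.erase i₀, (∏ j', factor S x i' j' U) * x ^ d i' :=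
      hQ' _ (fun i => ∏ j, factor S x i j U) fun i hi =>
        Finset.prod_congr rfl fun j _ => hMne i hi j
    rw [this, remainder]
    field_simp
    ring
  simp only [hH]
  rw [hMe, hM0, hQU, hΨU, mul_div_assoc]

end MonomialDerivative

/-! ### The linear combination R -/

section LinearCombination

variable {m : ℕ} [NeZero m] {k : Fin m → ℕ} {S : (i : Fin m) → Fin (k i) → Finset ℕ}
  {d : Fin m → ℕ} {x : ℝ}

theorem weightQ_pos (hS : ∀ i j, 0 ∈ S i j) (i : Fin m) (x : ℝ) : 0 < weightQ S i x :=
  Real.sqrt_pos.2 (div_pos (alphaProd_pos hS i x) (alphaProd_pos hS 0 x))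

theorem weightQ_zero (hS : ∀ i j, 0 ∈ S i j) (x : ℝ) : weightQ S 0 x = 1 := by
  rw [weightQ, div_self (alphaProd_pos hS 0 x).ne', Real.sqrt_one]

theorem deriv_weightQ_zero (hS : ∀ i j, 0 ∈ S i j) (x : ℝ) : deriv (weightQ S 0) x = 0 := by
  rw [show weightQ S 0 = fun _ => 1 from funext (weightQ_zero hS)]
  exact deriv_const x 1

omit [NeZero m] in
theorem differentiable_alphaProd (i : Fin m) : Differentiable ℝ (alphaProd S i) := by
  unfold alphaProd alpha
  fun_prop

theorem differentiableAt_weightQ (hS : ∀ i j, 0 ∈ S i j) (i : Fin m) (x : ℝ) :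
    DifferentiableAt ℝ (weightQ S i) x :=
  DifferentiableAt.sqrt (((differentiable_alphaProd i) x).div ((differentiable_alphaProd 0) x)
    (alphaProd_pos hS 0 x).ne') (div_pos (alphaProd_pos hS i x) (alphaProd_pos hS 0 x)).ne'

theorem deriv_linComb (hS : ∀ i j, 0 ∈ S i j) (u : EuclideanSpace ℝ (Fin m)) :
    deriv (fun y => linComb S d y u) x =
      ∑ i, u i * (deriv (weightQ S i) x * x ^ d i + weightQ S i x * (d i * x ^ (d i - 1))) := by
  refine HasDerivAt.deriv (HasDerivAt.fun_sum fun i _ => ?_)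
  have h := (((differentiableAt_weightQ hS i x).hasDerivAt).mul (hasDerivAt_pow (d i) x)).const_mul
    (u i)
  simpa only [Pi.mul_apply, mul_assoc] using h

/-- The random variable `R(x)` without its first summand. -/
def linCombTail (S : (i : Fin m) → Fin (k i) → Finset ℕ) (d : Fin m → ℕ) (x : ℝ)
    (u : Fin m → ℝ) : ℝ :=
  ∑ i ∈ Finset.univ.erase 0, u i * weightQ S i x * x ^ d i

theorem isAffineInCoord_linComb (hS : ∀ i j, 0 ∈ S i j) (hd : d 0 = 0) :
    IsAffineInCoord 0 (linComb S d x) (fun u => linCombTail S d x u.ofLp) fun _ => 1 where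
  contDiff_left := by
    unfold linCombTail
    fun_prop
  contDiff_right := contDiff_const
  eq u := by
    rw [linComb, ← Finset.sum_erase_add _ _ (Finset.mem_univ 0), weightQ_zero hS, hd]
    simp [linCombTail]
  left_update u t := Finset.sum_congr rfl fun i hi => by
    rw [updateCoord_of_ne (Finset.ne_of_mem_erase hi)]
  right_update _ _ := rfl

/-- The first variable enters R with coefficient q_1 x^{d_1} = 1, so the level set is a hyperplane
and the lower bound in graph coordinates applies with B = 1. -/
theorem lintegral_le_riceIntegrand_linComb (hk : ∀ i, 1 ≤ k i) (hS : ∀ i j, 0 ∈ S i j)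
    (hd : d 0 = 0) (z : ℝ) :
    ∫⁻ w : Fin m → ℝ, ENNReal.ofReal |∑ i, w i *
        (deriv (weightQ S i) x * x ^ d i + weightQ S i x * (d i * x ^ (d i - 1)))| *
        gaussianProdDensity (k 0) (z - linCombTail S d x w)
        ∂Measure.pi (fun i => (volume : Measure ℝ).withDensity (gaussianProdDensity (k i))) ≤
      riceIntegrand (gaussianProdsDensity k) (linComb S d) x z := by
  have hprob : ∀ i, IsProbabilityMeasure
      ((volume : Measure ℝ).withDensity (gaussianProdDensity (k i))) := fun i =>
    isProbabilityMeasure_withDensity_gaussianProdDensity (hk i)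
  have hZ : Measurable fun u : EuclideanSpace ℝ (Fin m) =>
      ENNReal.ofReal |deriv (fun y => linComb S d y u) x| := by
    simp only [deriv_linComb hS]
    have : Measurable fun u : EuclideanSpace ℝ (Fin m) => ∑ i, u i *
        (deriv (weightQ S i) x * x ^ d i + weightQ S i x * (d i * x ^ (d i - 1))) := by fun_prop
    exact (measurable_norm.comp this).ennreal_ofReal
  let c : EuclideanSpace ℝ {j : Fin m // j ≠ 0} →L[ℝ] ℝ :=
    -((∑ i ∈ Finset.univ.erase 0, (weightQ S i x * x ^ d i) • EuclideanSpace.proj i).comp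
      (coordHyperplane (0 : Fin m)).toContinuousLinearMap)
  have h := (isAffineInCoord_linComb (x := x) hS hd).le_condExpMulDensity z
    (p := fun i => gaussianProdDensity (k i)) (fun i => measurable_gaussianProdDensity (k i)) hZ
    (fun _ => one_ne_zero) (b := z) (c := c) fun y => by
      simp only [IsAffineInCoord.height, linCombTail, div_one, c, sub_eq_add_neg]
      congr 1
      simp [mul_assoc, mul_comm]
  refine le_trans (le_of_eq (lintegral_congr fun w => ?_)) h
  rw [deriv_linComb hS]
  simp only [div_one, abs_one, ENNReal.ofReal_one]
  congr 3
  refine Finset.sum_congr rfl fun (i : Fin m) _ => ?_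
  -- The coordinate solved for has coefficient 0 in R', since q_1 is constant and d_1 = 0.
  by_cases hi : i = 0
  · subst hi
    simp [deriv_weightQ_zero hS, hd]
  · rw [updateCoord_of_ne hi]

end LinearCombination

/-! ### The cost of differentiating the weights q_i -/

section ErrorTerm

/-- The bound |t| ϖ_l(t) ≤ 1 replaces the weight by Lebesgue measure, and then |c| ∫ ϖ_k(b - c t) dt
= 1. -/
theorem lintegral_abs_mul_gaussianProdDensity_sub_le {k l : ℕ} (hk : 1 ≤ k) (b : ℝ) {c : ℝ}
    (hc : c ≠ 0) :
    ENNReal.ofReal |c| * ∫⁻ t, ENNReal.ofReal |t| * gaussianProdDensity k (b - c * t)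
      ∂(volume : Measure ℝ).withDensity (gaussianProdDensity l) ≤ 1 := by
  have hkm := measurable_gaussianProdDensity k
  have hlm := measurable_gaussianProdDensity l
  have hm : Measurable fun t => gaussianProdDensity k (b - c * t) := hkm.comp (by fun_prop)
  have ha : Measurable fun t : ℝ => ENNReal.ofReal |t| := measurable_norm.ennreal_ofReal
  rw [lintegral_withDensity_eq_lintegral_mul _ hlm
    (g := fun t => ENNReal.ofReal |t| * gaussianProdDensity k (b - c * t)) (ha.mul hm)]
  calc _ ≤ ENNReal.ofReal |c| * ∫⁻ t, gaussianProdDensity k (b - c * t) := by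
        refine mul_le_mul_right (lintegral_mono fun t => ?_) _
        simp only [Pi.mul_apply]
        rw [← mul_assoc, mul_comm (gaussianProdDensity l t)]
        exact mul_le_of_le_one_left zero_le (abs_mul_gaussianProdDensity_le_one l t)
    _ = ∫⁻ t, gaussianProdDensity k (b - t) :=
        ofReal_abs_mul_lintegral_comp_mul_left hc (f := fun t => gaussianProdDensity k (b - t))
          (hkm.comp (by fun_prop))
    _ = ∫⁻ t, gaussianProdDensity k t := lintegral_sub_left_eq_self _ b
    _ ≤ 1 := by
        have := isProbabilityMeasure_withDensity_gaussianProdDensity hk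
        have h := measure_univ (μ := (volume : Measure ℝ).withDensity (gaussianProdDensity k))
        rw [withDensity_apply _ MeasurableSet.univ, Measure.restrict_univ] at h
        exact h.le

variable {m : ℕ} [NeZero m] {k : Fin m → ℕ} {S : (i : Fin m) → Fin (k i) → Finset ℕ}
  {d : Fin m → ℕ} {x : ℝ}

theorem measurable_linCombTail : Measurable (linCombTail S d x) := by
  unfold linCombTail
  fun_prop

theorem measurable_gaussianProdDensity_sub_linCombTail (z : ℝ) :
    Measurable fun w : Fin m → ℝ => gaussianProdDensity (k 0) (z - linCombTail S d x w) :=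
  (measurable_gaussianProdDensity _).comp (measurable_const.sub measurable_linCombTail)

/-- Integrate over w_i first. The argument of ϖ_{k_1} has slope -c in w_i with c = q_i x^{d_i}, and
q_i' x^{d_i} = (q_i'/q_i) c. -/
theorem lintegral_abs_mul_deriv_weightQ_le (hk : ∀ i, 1 ≤ k i) (hS : ∀ i j, 0 ∈ S i j) (z : ℝ)
    (i : Fin m) :
    ∫⁻ w : Fin m → ℝ, ENNReal.ofReal |w i * (deriv (weightQ S i) x * x ^ d i)| *
        gaussianProdDensity (k 0) (z - linCombTail S d x w)
        ∂Measure.pi (fun i => (volume : Measure ℝ).withDensity (gaussianProdDensity (k i))) ≤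
      ENNReal.ofReal |deriv (weightQ S i) x / weightQ S i x| := by
  have hprob : ∀ i, IsProbabilityMeasure
      ((volume : Measure ℝ).withDensity (gaussianProdDensity (k i))) := fun i =>
    isProbabilityMeasure_withDensity_gaussianProdDensity (hk i)
  by_cases h0 : deriv (weightQ S i) x * x ^ d i = 0
  · simp [h0]
  have hi : i ≠ 0 := by
    rintro rfl
    simp [deriv_weightQ_zero hS] at h0
  have hq := weightQ_pos hS i x
  have hc : weightQ S i x * x ^ d i ≠ 0 := mul_ne_zero hq.ne' (right_ne_zero_of_mul h0)
  have hm : Measurable fun w : Fin m → ℝ => ENNReal.ofReal |w i * (deriv (weightQ S i) x * x ^ d i)| := by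
    have : Measurable fun w : Fin m → ℝ => w i * (deriv (weightQ S i) x * x ^ d i) := by fun_prop
    exact (measurable_norm.comp this).ennreal_ofReal
  have hg : Measurable fun w : Fin m → ℝ => ENNReal.ofReal |w i * (deriv (weightQ S i) x * x ^ d i)| *
      gaussianProdDensity (k 0) (z - linCombTail S d x w) :=
    hm.mul (measurable_gaussianProdDensity_sub_linCombTail z)
  rw [lintegral_pi_update _ hg i]
  refine (lintegral_mono
    (g := fun _ => ENNReal.ofReal |deriv (weightQ S i) x / weightQ S i x|) fun w => ?_).trans (by simp)
  have htail : ∀ t, linCombTail S d x (Function.update w i t) =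
      ∑ i' ∈ (Finset.univ.erase 0).erase i, w i' * weightQ S i' x * x ^ d i' +
        weightQ S i x * x ^ d i * t := by
    intro t
    rw [linCombTail, ← Finset.sum_erase_add _ _ (Finset.mem_erase.2 ⟨hi, Finset.mem_univ i⟩)]
    congr 1
    · exact Finset.sum_congr rfl fun i' hi' => by
        rw [Function.update_of_ne (Finset.ne_of_mem_erase hi')]
    · rw [Function.update_self]
      ring
  have hcoef : ENNReal.ofReal |deriv (weightQ S i) x * x ^ d i| =
      ENNReal.ofReal |deriv (weightQ S i) x / weightQ S i x| *
        ENNReal.ofReal |weightQ S i x * x ^ d i| := by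
    rw [← ENNReal.ofReal_mul (abs_nonneg _), ← abs_mul]
    congr 2
    field_simp
  simp only [htail, ← sub_sub, Function.update_self, abs_mul (_ : ℝ) (deriv _ _ * _),
    ENNReal.ofReal_mul (abs_nonneg _)]
  rw [hcoef]
  calc _ = ENNReal.ofReal |deriv (weightQ S i) x / weightQ S i x| *
        (ENNReal.ofReal |weightQ S i x * x ^ d i| * ∫⁻ t, ENNReal.ofReal |t| *
          gaussianProdDensity (k 0) (z - ∑ i' ∈ (Finset.univ.erase 0).erase i,
            w i' * weightQ S i' x * x ^ d i' - weightQ S i x * x ^ d i * t)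
          ∂(volume : Measure ℝ).withDensity (gaussianProdDensity (k i))) := by
        rw [← mul_assoc, ← lintegral_const_mul' _ _
          (ENNReal.mul_ne_top ENNReal.ofReal_ne_top ENNReal.ofReal_ne_top)]
        refine lintegral_congr fun t => ?_
        ring
    _ ≤ _ := mul_le_of_le_one_right zero_le
        (lintegral_abs_mul_gaussianProdDensity_sub_le (hk 0) _ hc)

/-- Normalizing by the standard deviation of the first product turns A_i into q_i and a into ζ. The
coefficient q_i d_i x^{d_i - 1} is that of R' minus q_i' x^{d_i}, so the triangle inequality
separates the error from the integrand for R. -/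
theorem condExpMulDensity_monomialDeriv_le_riceIntegrand (hk : ∀ i, 1 ≤ k i)
    (hS : ∀ i j, 0 ∈ S i j) (hd : d 0 = 0) {a : ℝ} (ha : a ≠ 0) :
    condExpMulDensity (gaussianDensity S) (sumProd S d x)
      (fun u => ENNReal.ofReal |monomialDeriv S d x u|) a ≤
    ENNReal.ofReal (∑ i, |deriv (weightQ S i) x / weightQ S i x|) +
      riceIntegrand (gaussianProdsDensity k) (linComb S d) x (a / √(alphaProd S 0 x)) := by
  set z := a / √(alphaProd S 0 x) with hz
  set A : Fin m → ℝ := fun i => √(alphaProd S i x) with hA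
  have hA0 : 0 < A 0 := Real.sqrt_pos.2 (alphaProd_pos hS 0 x)
  have hAq : ∀ i, A i = A 0 * weightQ S i x := fun i => by
    rw [weightQ, Real.sqrt_div (alphaProd_pos hS i x).le, mul_div_cancel₀ _ hA0.ne']
  have hconv : ∀ w : Fin m → ℝ, ENNReal.ofReal |∑ i, A i * w i * (d i * x ^ (d i - 1))| *
        ((ENNReal.ofReal (A 0))⁻¹ * gaussianProdDensity (k 0)
          ((a - ∑ i ∈ Finset.univ.erase 0, A i * w i * x ^ d i) / A 0)) =
      ENNReal.ofReal |∑ i, w i * (weightQ S i x * (d i * x ^ (d i - 1)))| *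
        gaussianProdDensity (k 0) (z - linCombTail S d x w) := by
    intro w
    have h1 : ∑ i, A i * w i * (d i * x ^ (d i - 1)) =
        A 0 * ∑ i, w i * (weightQ S i x * (d i * x ^ (d i - 1))) := by
      rw [Finset.mul_sum]
      exact Finset.sum_congr rfl fun i _ => by rw [hAq i]; ring
    have h2 : (a - ∑ i ∈ Finset.univ.erase 0, A i * w i * x ^ d i) / A 0 =
        z - linCombTail S d x w := by
      have : ∑ i ∈ Finset.univ.erase 0, A i * w i * x ^ d i = A 0 * linCombTail S d x w := by
        rw [linCombTail, Finset.mul_sum]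
        exact Finset.sum_congr rfl fun i _ => by rw [hAq i]; ring
      rw [this, sub_div, mul_div_cancel_left₀ _ hA0.ne']
    rw [h1, h2, abs_mul, abs_of_pos hA0, ENNReal.ofReal_mul hA0.le, ← mul_assoc,
      mul_right_comm (ENNReal.ofReal (A 0)),
      ENNReal.mul_inv_cancel (ENNReal.ofReal_pos.2 hA0).ne' ENNReal.ofReal_ne_top, one_mul]
  refine (condExpMulDensity_monomialDeriv_le hk hS hd ha (A := A) fun _ => rfl).trans ?_
  simp only [hconv]
  have hW := measurable_gaussianProdDensity_sub_linCombTail (S := S) (d := d) (x := x) z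
  have hm : ∀ i, Measurable fun w : Fin m → ℝ =>
      ENNReal.ofReal |w i * (deriv (weightQ S i) x * x ^ d i)| := fun i => by
    have : Measurable fun w : Fin m → ℝ => w i * (deriv (weightQ S i) x * x ^ d i) := by fun_prop
    exact (measurable_norm.comp this).ennreal_ofReal
  have hg : ∀ i, Measurable fun w : Fin m → ℝ =>
      ENNReal.ofReal |w i * (deriv (weightQ S i) x * x ^ d i)| *
        gaussianProdDensity (k 0) (z - linCombTail S d x w) := fun i => (hm i).mul hW
  calc _ ≤ ∫⁻ w : Fin m → ℝ, (∑ i, ENNReal.ofReal |w i * (deriv (weightQ S i) x * x ^ d i)| *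
          gaussianProdDensity (k 0) (z - linCombTail S d x w)) +
          ENNReal.ofReal |∑ i, w i *
            (deriv (weightQ S i) x * x ^ d i + weightQ S i x * (d i * x ^ (d i - 1)))| *
          gaussianProdDensity (k 0) (z - linCombTail S d x w)
          ∂Measure.pi (fun i => (volume : Measure ℝ).withDensity (gaussianProdDensity (k i))) := by
        refine lintegral_mono fun w => ?_
        rw [← Finset.sum_mul, ← add_mul]
        refine mul_le_mul_left ?_ _
        rw [← ENNReal.ofReal_sum_of_nonneg fun _ _ => abs_nonneg _,
          ← ENNReal.ofReal_add (Finset.sum_nonneg fun _ _ => abs_nonneg _) (abs_nonneg _)]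
        refine ENNReal.ofReal_le_ofReal ?_
        have h : ∑ i, w i * (weightQ S i x * (d i * x ^ (d i - 1))) =
            ∑ i, w i * (deriv (weightQ S i) x * x ^ d i + weightQ S i x * (d i * x ^ (d i - 1))) -
            ∑ i, w i * (deriv (weightQ S i) x * x ^ d i) := by
          rw [← Finset.sum_sub_distrib]
          exact Finset.sum_congr rfl fun i _ => by ring
        rw [h, add_comm]
        exact (abs_sub _ _).trans (by gcongr; exact Finset.abs_sum_le_sum_abs _ _)
    _ ≤ _ := by
        rw [lintegral_add_left (Finset.measurable_sum _ fun i _ => hg i),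
          lintegral_finsetSum _ fun i _ => hg i,
          ENNReal.ofReal_sum_of_nonneg fun _ _ => abs_nonneg _]
        exact add_le_add (Finset.sum_le_sum fun i _ => lintegral_abs_mul_deriv_weightQ_le hk hS z i)
          (lintegral_le_riceIntegrand_linComb hk hS hd z)

end ErrorTerm

/-! ### The β' term and the conclusion -/

section FactorDerivatives

theorem deriv_beta (S : Finset ℕ) (y : ℝ) :
    deriv (beta S) y = ∑ s : S, ((s : ℕ) : ℝ) * y ^ ((s : ℕ) - 1) := by
  rw [Finset.sum_coe_sort S fun s => (s : ℝ) * y ^ (s - 1)]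
  exact (HasDerivAt.fun_sum fun s _ => hasDerivAt_pow s y).deriv

variable {m : ℕ} {k : Fin m → ℕ} {S : (i : Fin m) → Fin (k i) → Finset ℕ} {d : Fin m → ℕ} {x : ℝ}

theorem riceIntegrand_sumProd_le (hS : ∀ i j, 0 ∈ S i j) (a : ℝ) :
    riceIntegrand (gaussianDensity S) (sumProd S d) x a ≤
      ENNReal.ofReal ((√(2 * Real.pi))⁻¹ * ∑ i, ∑ j, deriv (beta (S i j)) |x|) +
      condExpMulDensity (gaussianDensity S) (sumProd S d x)
        (fun u => ENNReal.ofReal |monomialDeriv S d x u|) a := by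
  have hw : Measurable fun u => gaussianDensity S u / ENNReal.ofReal ‖gradient (sumProd S d x) u‖ :=
    measurable_density_div_norm_gradient (p := fun _ => gaussianPDF 0 1)
      (fun _ => measurable_gaussianPDF 0 1) _
  have hm := fun i j l => measurable_abs_coord_mul_abs_cofactor (S := S) (d := d) (x := x) i j l
  refine (condExpMulDensity_mono (fun u => abs_deriv_sumProd_le u x) a).trans ?_
  have h3 : ∀ i j (s : S i j), Measurable fun u : EuclideanSpace ℝ (Params S) =>
      ENNReal.ofReal ((s : ℕ) * |x| ^ ((s : ℕ) - 1)) *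
        (ENNReal.ofReal |u ⟨i, j, s⟩| * ENNReal.ofReal |cofactor S d x i j u|) :=
    fun i j s => (hm i j _).const_mul _
  have h2 := fun i j => Finset.measurable_sum Finset.univ fun s _ => h3 i j s
  have h1 := fun i => Finset.measurable_sum Finset.univ fun j _ => h2 i j
  have h0 := Finset.measurable_sum Finset.univ fun i _ => h1 i
  rw [condExpMulDensity_add hw h0]
  refine add_le_add_left ?_ _
  rw [condExpMulDensity_sum hw _ fun i _ => h1 i, Finset.mul_sum,
    ENNReal.ofReal_sum_of_nonneg]
  swap
  · intro i _
    refine mul_nonneg (by positivity) (Finset.sum_nonneg fun j _ => ?_)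
    rw [deriv_beta]
    positivity
  refine Finset.sum_le_sum fun i _ => ?_
  rw [condExpMulDensity_sum hw _ fun j _ => h2 i j, Finset.mul_sum,
    ENNReal.ofReal_sum_of_nonneg]
  swap
  · intro j _
    rw [deriv_beta]
    positivity
  refine Finset.sum_le_sum fun j _ => ?_
  rw [condExpMulDensity_sum hw _ fun s _ => h3 i j s, deriv_beta, Finset.mul_sum,
    ENNReal.ofReal_sum_of_nonneg fun s _ => by positivity]
  refine Finset.sum_le_sum fun s _ => ?_
  rw [condExpMulDensity_const_mul hw _ (hm i j _), mul_comm (√(2 * Real.pi))⁻¹,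
    ENNReal.ofReal_mul (q := (√(2 * Real.pi))⁻¹) (by positivity)]
  -- The constant term has weight s = 0 in f_ij', so the one coefficient not covered by the estimate
  -- is not needed.
  by_cases hs : (s : ℕ) = 0
  · simp [hs]
  · exact mul_le_mul_right (condExpMulDensity_coord_mul_cofactor_le hS i j s hs a) _

end FactorDerivatives

end

end SPSP

theorem proposition5p4 {m : ℕ} [NeZero m] (k : Fin m → ℕ) (hk : ∀ i, 1 ≤ k i)
    (S : (i : Fin m) → Fin (k i) → Finset ℕ) (hS : ∀ i j, 0 ∈ S i j)
    (d : Fin m → ℕ) (hd0 : d 0 = 0) (hd : Monotone d)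
    (x a : ℝ) (ha : a ≠ 0) :
    SPSP.riceIntegrand (SPSP.gaussianDensity S) (SPSP.sumProd S d) x a ≤
      ENNReal.ofReal ((√(2 * Real.pi))⁻¹ * ∑ i, ∑ j, deriv (SPSP.beta (S i j)) |x|)
      + ENNReal.ofReal (∑ i, |deriv (SPSP.weightQ S i) x / SPSP.weightQ S i x|)
      + SPSP.riceIntegrand (SPSP.gaussianProdsDensity k) (SPSP.linComb S d) x
          (a / √(SPSP.alphaProd S 0 x)) := by
  rw [add_assoc]
  exact (SPSP.riceIntegrand_sumProd_le hS a).trans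
    (add_le_add_right
      (SPSP.condExpMulDensity_monomialDeriv_le_riceIntegrand hk hS hd0 ha) _)
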